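/- Let $p<q$ be primes and let $G$ be a nonabelian group of order $pq^2$. Write $G'$ for the commutator subgroup of $G$, $M(G)=H_2(G,\mathbb{Z})$ for its Schur multiplier, and $G\otimes G$ for its non-abelian tensor square, i.e. the group generated by the symbols $g\otimes h$ $(g,h\in G)$ subject to the relations $g_1g\otimes h=({}^{g_1}g\otimes{}^{g_1}h)(g_1\otimes h)$ and $g\otimes h_1h=(g\otimes h_1)({}^{h_1}g\otimes{}^{h_1}h)$ for all $g,g_1,h,h_1\in G$, where ${}^{x}y=xyx^{-1}$. Then one of the following three cases occurs, with the stated structure of $G\otimes G$: (i) if $G'\cong\mathbb{Z}_{q^2}$, then $G\otimes G\cong\mathbb{Z}_{pq^2}$; (ii) if $G'\cong\mathbb{Z}_q\times\mathbb{Z}_q$ and $M(G)=0$, or if $G'\cong\mathbb{Z}_q$, then $G\otimes G\cong\mathbb{Z}_p\times(\mathbb{Z}_q)^2$; (iii) if $G'\cong\mathbb{Z}_q\times\mathbb{Z}_q$ and $M(G)\cong\mathbb{Z}_q$, then $G\otimes G\cong\mathbb{Z}_p\times H$ for some extraspecial $q$-group $H$ of order $q^3$, i.e. a group $H$ of order $q^3$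 whose centre $Z(H)$ has order $q$ and whose quotient $H/Z(H)$ is a nontrivial elementary abelian $q$-group. -/

import Mathlib

universe u

/-- The defining relators of the non-abelian tensor square of a group `G`, where `G` acts on itself
by conjugation `ᵍx = g * x * g⁻¹` and the free generator indexed by `(g, h)` is the symbol `g ⊗ h`:
`g₁g ⊗ h = (ᵍ¹g ⊗ ᵍ¹h)(g₁ ⊗ h)` and `g ⊗ h₁h = (g ⊗ h₁)(ʰ¹g ⊗ ʰ¹h)`. -/
inductive TensorSquareRel (G : Type u) [Group G] : FreeGroup (G × G) → Prop
  | mul_left (g₁ g h : G) : TensorSquareRel G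
      (FreeGroup.of (g₁ * g, h) *
        (FreeGroup.of (g₁ * g * g₁⁻¹, g₁ * h * g₁⁻¹) * FreeGroup.of (g₁, h))⁻¹)
  | mul_right (g h₁ h : G) : TensorSquareRel G
      (FreeGroup.of (g, h₁ * h) *
        (FreeGroup.of (g, h₁) * FreeGroup.of (h₁ * g * h₁⁻¹, h₁ * h * h₁⁻¹))⁻¹)

/-- The non-abelian tensor square `G ⊗ G` of Brown and Loday. -/
abbrev TensorSquare (G : Type u) [Group G] : Type u :=
  PresentedGroup {r : FreeGroup (G × G) | TensorSquareRel G r}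

/-- The Schur multiplier `M(G) = H₂(G, ℤ)`, with trivial action on `ℤ`. The integers are lifted to
the universe of `G`, since group homology is defined for a ring and a group in one universe. -/
noncomputable abbrev SchurMultiplier (G : Type u) [Group G] : Type u :=
  groupHomology.H2 (Rep.trivial (ULift.{u} ℤ) G (ULift.{u} ℤ))

/-- A `q`-group `H` (`q` prime) is extraspecial if its centre `Z` has order `q` and `H ⧸ Z` is a
nontrivial elementary abelian `q`-group. -/
structure IsExtraspecial (q : ℕ) (H : Type u) [Group H] : Prop where
  isPGroup : IsPGroup q H
  card_center : Nat.card (Subgroup.center H) = q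
  nontrivial_quotient : Nontrivial (H ⧸ Subgroup.center H)
  comm_quotient : ∀ a b : H ⧸ Subgroup.center H, a * b = b * a
  pow_quotient : ∀ a : H ⧸ Subgroup.center H, a ^ q = 1

/-! Write κ for the commutator map `toCommutator`, n for the order of the abelianization, and Ω for
`derivedSquare`, generated by the symbols v ⊗ w with v, w in G'. The map κ is a crossed module, so
its kernel is central and fixed by G.

A subgroup of order q² is normal with cyclic quotient, so G' is abelian of order q or q², and the
abelianization is cyclic of order n = pq or p, generated by the image of some s. Then v ↦ ⁅v, s⁆ is
an automorphism of G', which forces s ^ n = 1. Every tensor has the form ω (s ⊗ s)^k (v ⊗ s) with ω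
in Ω and v in G' (`exists_eq_mul`). The central element s ⊗ s splits off a factor ℤ/n, detected by
`pairing`, and the complement is a central extension of G' by Ω.

It remains to find Ω. The symbols on G' form an alternating bilinear pairing, so Ω is trivial if G'
is cyclic and has order 1 or q if G' = (ℤ/q)². Mapping G ⊗ G to a universal central extension gives
|M(G)| ∣ |Ω| (`card_schurMultiplier_dvd`), so |Ω| = q if M(G) = ℤ/q. If M(G) = 0, the pairing,
extended to a 2-cocycle on G, must be symmetric on commuting pairs; being alternating as well, it
vanishes because q is odd. When |Ω| = q, the identity ⁅τ, σ⁆ = κτ ⊗ κσ makes the complement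
nonabelian of order q³. -/

namespace TensorSquare

/-! ### The tensor square as a crossed module -/

variable {G : Type u} [Group G]

/-- The symbol `g ⊗ h` in the non-abelian tensor square. -/
def tmul (g h : G) : TensorSquare G := PresentedGroup.of (g, h)

scoped infix:75 " ⊗ₙ " => TensorSquare.tmul

theorem mul_tmul (g₁ g h : G) :
    (g₁ * g) ⊗ₙ h = ((g₁ * g * g₁⁻¹) ⊗ₙ (g₁ * h * g₁⁻¹)) * (g₁ ⊗ₙ h) := by
  have := PresentedGroup.one_of_mem (rels := {r : FreeGroup (G × G) | TensorSquareRel G r})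
    (TensorSquareRel.mul_left g₁ g h)
  rw [map_mul, map_inv, mul_inv_eq_one, map_mul] at this
  exact this

theorem tmul_mul (g h₁ h : G) :
    g ⊗ₙ (h₁ * h) = (g ⊗ₙ h₁) * ((h₁ * g * h₁⁻¹) ⊗ₙ (h₁ * h * h₁⁻¹)) := by
  have := PresentedGroup.one_of_mem (rels := {r : FreeGroup (G × G) | TensorSquareRel G r})
    (TensorSquareRel.mul_right g h₁ h)
  rw [map_mul, map_inv, mul_inv_eq_one, map_mul] at this
  exact this

section lift

variable {K : Type*} [Group K]

/-- A crossed pairing `f` on `G` induces a homomorphism out of the tensor square. -/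
def lift (f : G → G → K)
    (hl : ∀ g₁ g h, f (g₁ * g) h = f (g₁ * g * g₁⁻¹) (g₁ * h * g₁⁻¹) * f g₁ h)
    (hr : ∀ g h₁ h, f g (h₁ * h) = f g h₁ * f (h₁ * g * h₁⁻¹) (h₁ * h * h₁⁻¹)) :
    TensorSquare G →* K :=
  PresentedGroup.toGroup (f := fun x => f x.1 x.2) (by
    rintro r (⟨g₁, g, h⟩ | ⟨g, h₁, h⟩)
    · simp [hl g₁ g h]
    · simp [hr g h₁ h])

@[simp]
theorem lift_tmul (f : G → G → K) (hl hr) (g h : G) : lift f hl hr (g ⊗ₙ h) = f g h :=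
  PresentedGroup.toGroup.of _

theorem hom_ext {φ ψ : TensorSquare G →* K} (h : ∀ a b : G, φ (a ⊗ₙ b) = ψ (a ⊗ₙ b)) : φ = ψ :=
  PresentedGroup.ext fun x => h x.1 x.2

end lift

theorem eq_top_of_tmul_mem {S : Subgroup (TensorSquare G)} (h : ∀ a b : G, a ⊗ₙ b ∈ S) :
    S = ⊤ :=
  eq_top_iff.2 fun x _ => PresentedGroup.generated_by _ S (fun x => h x.1 x.2) x

/-- The diagonal conjugation action of `G` on its tensor square. -/
def act (x : G) : TensorSquare G →* TensorSquare G :=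
  lift (fun g h => (x * g * x⁻¹) ⊗ₙ (x * h * x⁻¹))
    (fun g₁ g h => by
      have := mul_tmul (x * g₁ * x⁻¹) (x * g * x⁻¹) (x * h * x⁻¹)
      convert this using 2 <;> group)
    (fun g h₁ h => by
      have := tmul_mul (x * g * x⁻¹) (x * h₁ * x⁻¹) (x * h * x⁻¹)
      convert this using 2 <;> group)

@[simp]
theorem act_tmul (x g h : G) : act x (g ⊗ₙ h) = (x * g * x⁻¹) ⊗ₙ (x * h * x⁻¹) :=
  lift_tmul _ _ _ _ _

theorem act_mul (x y : G) (τ : TensorSquare G) : act (x * y) τ = act x (act y τ) := by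
  have : act (x * y) = (act x).comp (act y) := hom_ext fun a b => by simp [mul_assoc]
  rw [this]; rfl

@[simp]
theorem act_one (τ : TensorSquare G) : act 1 τ = τ := by
  have : act (1 : G) = MonoidHom.id _ := hom_ext fun a b => by simp
  rw [this]; rfl

theorem mul_tmul' (g₁ g h : G) : (g₁ * g) ⊗ₙ h = act g₁ (g ⊗ₙ h) * (g₁ ⊗ₙ h) := by
  rw [act_tmul, mul_tmul]

theorem tmul_mul' (g h₁ h : G) : g ⊗ₙ (h₁ * h) = (g ⊗ₙ h₁) * act h₁ (g ⊗ₙ h) := by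
  rw [act_tmul, tmul_mul]

@[simp]
theorem one_tmul (h : G) : (1 : G) ⊗ₙ h = 1 := by
  have := mul_tmul' 1 1 h
  rw [act_one, mul_one] at this
  exact left_eq_mul.1 this

@[simp]
theorem tmul_one (g : G) : g ⊗ₙ (1 : G) = 1 := by
  have := tmul_mul' g 1 1
  rw [act_one, mul_one] at this
  exact left_eq_mul.1 this

theorem inv_tmul (g h : G) : g⁻¹ ⊗ₙ h = (act g⁻¹ (g ⊗ₙ h))⁻¹ := by
  have := mul_tmul' g⁻¹ g h
  rw [inv_mul_cancel, one_tmul] at this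
  exact eq_inv_of_mul_eq_one_right this.symm

theorem tmul_inv (g h : G) : g ⊗ₙ h⁻¹ = (act h⁻¹ (g ⊗ₙ h))⁻¹ := by
  have := tmul_mul' g h⁻¹ h
  rw [inv_mul_cancel, tmul_one] at this
  exact eq_inv_of_mul_eq_one_left this.symm

open scoped commutatorElement

/-- The commutator homomorphism `g ⊗ h ↦ ⁅g, h⁆`. -/
def toCommutator : TensorSquare G →* G :=
  lift (fun g h => ⁅g, h⁆) (fun g₁ g h => by simp only [commutatorElement_def]; group)
    (fun g h₁ h => by simp only [commutatorElement_def]; group)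

@[simp]
theorem toCommutator_tmul (g h : G) : toCommutator (g ⊗ₙ h) = ⁅g, h⁆ := lift_tmul _ _ _ _ _

theorem toCommutator_act (x : G) (τ : TensorSquare G) :
    toCommutator (act x τ) = x * toCommutator τ * x⁻¹ := by
  have : toCommutator.comp (act x) = (MulAut.conj x).toMonoidHom.comp toCommutator :=
    hom_ext fun a b => by simp [commutatorElement_def, mul_assoc]
  simpa using DFunLike.congr_fun this τ

/-- The flip `g ⊗ h ↦ (h ⊗ g)⁻¹`. -/
def flip : TensorSquare G →* TensorSquare G :=
  lift (fun g h => (h ⊗ₙ g)⁻¹) (fun g₁ g h => by rw [tmul_mul, mul_inv_rev])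
    (fun g h₁ h => by rw [mul_tmul, mul_inv_rev])

@[simp]
theorem flip_tmul (g h : G) : flip (g ⊗ₙ h) = (h ⊗ₙ g)⁻¹ := lift_tmul _ _ _ _ _

@[simp]
theorem flip_flip (τ : TensorSquare G) : flip (flip τ) = τ := by
  have : flip.comp flip = MonoidHom.id (TensorSquare G) := hom_ext fun a b => by simp
  exact DFunLike.congr_fun this τ

@[simp]
theorem toCommutator_flip (τ : TensorSquare G) : toCommutator (flip τ) = toCommutator τ := by
  have : toCommutator.comp flip = toCommutator (G := G) := hom_ext fun a b => by simp
  exact DFunLike.congr_fun this τ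

theorem flip_act (x : G) (τ : TensorSquare G) : flip (act x τ) = act x (flip τ) := by
  have : flip.comp (act x) = (act x).comp flip := hom_ext fun a b => by simp
  exact DFunLike.congr_fun this τ

/-- Expanding (ga) ⊗ (hb) first on the left or first on the right gives two products whose outer
factors agree; cancelling them leaves `key`. -/
theorem tmul_conj_tmul (g h a b : G) :
    (g ⊗ₙ h) * (a ⊗ₙ b) * (g ⊗ₙ h)⁻¹ = act ⁅g, h⁆ (a ⊗ₙ b) := by
  have key (a b : G) : act (g * h) (a ⊗ₙ b) * (g ⊗ₙ h) = (g ⊗ₙ h) * act (h * g) (a ⊗ₙ b) := by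
    have h₁ : (g * a) ⊗ₙ (h * b) = act g ((a ⊗ₙ h) * act h (a ⊗ₙ b)) *
        ((g ⊗ₙ h) * act h (g ⊗ₙ b)) := by rw [mul_tmul', tmul_mul' a, tmul_mul' g]
    have h₂ : (g * a) ⊗ₙ (h * b) = act g (a ⊗ₙ h) * (g ⊗ₙ h) *
        act h (act g (a ⊗ₙ b) * (g ⊗ₙ b)) := by rw [tmul_mul', mul_tmul' g a, mul_tmul' g a]
    rw [h₁] at h₂
    simp only [map_mul, ← act_mul, mul_assoc] at h₂
    have h₃ := mul_left_cancel h₂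
    simp only [← mul_assoc] at h₃
    exact mul_right_cancel h₃
  -- With a ⊗ b moved back by hg, the right side of `key` loses its action and the left side keeps
  -- gh(hg)⁻¹ = ⁅g, h⁆.
  have := key ((h * g)⁻¹ * a * (h * g)) ((h * g)⁻¹ * b * (h * g))
  have e : ((h * g)⁻¹ * a * (h * g)) ⊗ₙ ((h * g)⁻¹ * b * (h * g)) = act (h * g)⁻¹ (a ⊗ₙ b) := by
    simp
  rw [e, ← act_mul, ← act_mul, mul_inv_cancel, act_one] at this
  rw [← this, mul_inv_cancel_right]
  congr 1
  simp only [commutatorElement_def]; group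

/-- The Peiffer identity of the crossed module κ; it holds for symbols, and the τ satisfying it form
a subgroup. -/
theorem conj_eq_act (τ σ : TensorSquare G) : τ * σ * τ⁻¹ = act (toCommutator τ) σ := by
  let S : Subgroup (TensorSquare G) :=
    { carrier := {τ | ∀ σ, τ * σ * τ⁻¹ = act (toCommutator τ) σ}
      one_mem' := fun σ => by simp
      mul_mem' := fun {x y} hx hy σ => by
        rw [map_mul, act_mul, ← hy, ← hx]; group
      inv_mem' := fun {x} hx σ => by
        have := hx (x⁻¹ * σ * x)
        have h2 := congrArg (act (toCommutator x)⁻¹) this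
        rw [← act_mul, inv_mul_cancel, act_one] at h2
        rw [map_inv, inv_inv, ← h2]; group }
  have hS : S = ⊤ := by
    refine eq_top_of_tmul_mem fun a b σ => ?_
    have : (MulAut.conj (a ⊗ₙ b)).toMonoidHom = act (toCommutator (a ⊗ₙ b)) :=
      hom_ext fun c d => by simpa using tmul_conj_tmul a b c d
    simpa using DFunLike.congr_fun this σ
  exact (hS ▸ Subgroup.mem_top τ : τ ∈ S) σ

theorem commutator_tmul (a b g : G) : ⁅a, b⁆ ⊗ₙ g = (a ⊗ₙ b) * (act g (a ⊗ₙ b))⁻¹ := by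
  -- Two expansions of a ⊗ gb, with gb read as b · (b⁻¹gb) and as g · b.
  have h₁ : act b (a ⊗ₙ (b⁻¹ * g * b)) = (a ⊗ₙ b)⁻¹ * (a ⊗ₙ g) * act g (a ⊗ₙ b) := by
    have e₁ := tmul_mul' a b (b⁻¹ * g * b)
    have e₂ := tmul_mul' a g b
    rw [show b * (b⁻¹ * g * b) = g * b by group, e₂] at e₁
    rw [mul_assoc (a ⊗ₙ b)⁻¹, e₁, inv_mul_cancel_left]
  have h₂ : act ⁅a, b⁆ (act b (a ⊗ₙ (b⁻¹ * g * b))) =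
      (a ⊗ₙ g) * act g (a ⊗ₙ b) * (a ⊗ₙ b)⁻¹ := by
    rw [← toCommutator_tmul, ← conj_eq_act, h₁]; group
  have h₃ : (b * a⁻¹ * b⁻¹) ⊗ₙ g = act b (a⁻¹ ⊗ₙ (b⁻¹ * g * b)) := by simp; congr 1; group
  rw [show ⁅a, b⁆ = a * (b * a⁻¹ * b⁻¹) by simp only [commutatorElement_def]; group, mul_tmul', h₃,
    inv_tmul, map_inv, map_inv, ← act_mul, ← act_mul,
    show a * b * a⁻¹ = ⁅a, b⁆ * b by simp only [commutatorElement_def]; group, act_mul, h₂]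
  group

theorem toCommutator_tmul_right (τ : TensorSquare G) (g : G) :
    toCommutator τ ⊗ₙ g = τ * (act g τ)⁻¹ := by
  let S : Subgroup (TensorSquare G) :=
    { carrier := {τ | toCommutator τ ⊗ₙ g = τ * (act g τ)⁻¹}
      one_mem' := by simp
      mul_mem' := fun {x y} hx hy => by
        simp only [Set.mem_ofPred_eq] at *
        rw [map_mul, mul_tmul', ← conj_eq_act, hx, hy, map_mul]; group
      inv_mem' := fun {x} hx => by
        simp only [Set.mem_ofPred_eq] at *
        rw [map_inv, inv_tmul, hx, ← map_inv, ← map_inv, ← conj_eq_act, map_inv]; group }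
  have hS : S = ⊤ := eq_top_of_tmul_mem fun a b => by
    simpa [S] using commutator_tmul a b g
  exact (hS ▸ Subgroup.mem_top τ : τ ∈ S)

theorem tmul_toCommutator (τ : TensorSquare G) (g : G) :
    g ⊗ₙ toCommutator τ = act g τ * τ⁻¹ := by
  have := congrArg flip (toCommutator_tmul_right (flip τ) g)
  rw [toCommutator_flip, flip_tmul, map_mul, map_inv, ← flip_act, flip_flip, flip_flip] at this
  rw [← inv_inv (g ⊗ₙ _), this]; group

theorem act_eq_of_mem_ker {τ : TensorSquare G} (h : τ ∈ (toCommutator (G := G)).ker) (g : G) :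
    act g τ = τ := by
  have := tmul_toCommutator τ g
  rw [MonoidHom.mem_ker.1 h, tmul_one] at this
  exact (mul_inv_eq_one.1 this.symm)

theorem ker_toCommutator_le_center :
    (toCommutator (G := G)).ker ≤ Subgroup.center (TensorSquare G) := fun τ h =>
  Subgroup.mem_center_iff.2 fun σ => by
    have := conj_eq_act τ σ
    rw [MonoidHom.mem_ker.1 h, act_one] at this
    exact (mul_inv_eq_iff_eq_mul.1 this).symm

/-- This ties the noncommutativity of the tensor square to the symbols on G'. -/
theorem commutatorElement_eq (τ σ : TensorSquare G) :
    ⁅τ, σ⁆ = toCommutator τ ⊗ₙ toCommutator σ := by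
  rw [toCommutator_tmul_right, ← conj_eq_act, commutatorElement_def]; group

/-- If g = κτ, then g acts on τ as conjugation by τ itself, hence trivially. -/
theorem tmul_self_of_mem_range {g : G} (h : g ∈ (toCommutator (G := G)).range) :
    g ⊗ₙ g = 1 := by
  obtain ⟨τ, rfl⟩ := h
  rw [tmul_toCommutator, ← conj_eq_act]; group

/-- A subgroup of the tensor square that is stable under `G` is everything as soon as it contains
the symbols in a set of generators of `G`. -/
theorem eq_top_of_closure {S : Subgroup (TensorSquare G)} (hS : ∀ g, ∀ τ ∈ S, act g τ ∈ S)
    {X : Set G} (hX : Subgroup.closure X = ⊤) (h : ∀ x ∈ X, ∀ y ∈ X, x ⊗ₙ y ∈ S) : S = ⊤ := by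
  have h₁ (y : G) (hy : y ∈ X) (g : G) : g ⊗ₙ y ∈ S := by
    have hg : g ∈ Subgroup.closure X := hX ▸ Subgroup.mem_top g
    induction hg using Subgroup.closure_induction with
    | mem x hx => exact h x hx y hy
    | one => rw [one_tmul]; exact S.one_mem
    | mul a b _ _ ha hb => rw [mul_tmul']; exact S.mul_mem (hS _ _ hb) ha
    | inv a _ ha => rw [inv_tmul]; exact S.inv_mem (hS _ _ ha)
  refine eq_top_of_tmul_mem fun g k => ?_
  have hk : k ∈ Subgroup.closure X := hX ▸ Subgroup.mem_top k
  induction hk using Subgroup.closure_induction with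
  | mem x hx => exact h₁ x hx g
  | one => rw [tmul_one]; exact S.one_mem
  | mul a b _ _ ha hb => rw [tmul_mul']; exact S.mul_mem ha (hS _ _ hb)
  | inv a _ ha => rw [tmul_inv]; exact S.inv_mem (hS _ _ ha)

theorem range_toCommutator : (toCommutator (G := G)).range = commutator G := by
  apply le_antisymm
  · rintro _ ⟨τ, rfl⟩
    have : (commutator G).comap toCommutator = ⊤ := eq_top_of_tmul_mem fun a b => by
      rw [Subgroup.mem_comap, toCommutator_tmul]
      exact Subgroup.commutator_mem_commutator (Subgroup.mem_top _) (Subgroup.mem_top _)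
    exact (this ▸ Subgroup.mem_top τ : τ ∈ (commutator G).comap toCommutator)
  · exact Subgroup.commutator_le.2 fun a _ b _ => ⟨a ⊗ₙ b, toCommutator_tmul a b⟩

/-! ### Central extensions of the group -/

section central

variable {E : Type*} [Group E]

/-- Two lifts of an element differ by a central factor, which cancels in a commutator. -/
theorem commutatorElement_congr (p : E →* G) (hc : p.ker ≤ Subgroup.center E)
    {a a' b b' : E} (ha : p a = p a') (hb : p b = p b') :
    ⁅a, b⁆ = ⁅a', b'⁆ := by
  obtain ⟨z, hz, rfl⟩ : ∃ z ∈ Subgroup.center E, a = z * a' :=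
    ⟨a * a'⁻¹, hc (by simp [MonoidHom.mem_ker, ha]), by group⟩
  obtain ⟨w, hw, rfl⟩ : ∃ z ∈ Subgroup.center E, b = z * b' :=
    ⟨b * b'⁻¹, hc (by simp [MonoidHom.mem_ker, hb]), by group⟩
  rw [Subgroup.mem_center_iff] at hz hw
  have hz' (g : E) : z⁻¹ * g = g * z⁻¹ := by rw [inv_mul_eq_iff_eq_mul, ← mul_assoc, ← hz]; group
  simp only [commutatorElement_def, mul_inv_rev]
  calc z * a' * (w * b') * (a'⁻¹ * z⁻¹) * (b'⁻¹ * w⁻¹)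
      = (z * (a' * w) * b' * a'⁻¹) * (z⁻¹ * (b'⁻¹ * w⁻¹)) := by group
    _ = (z * (w * a') * b' * a'⁻¹) * ((b'⁻¹ * w⁻¹) * z⁻¹) := by rw [hw, hz']
    _ = ((z * w * a' * b' * a'⁻¹ * b'⁻¹ * w⁻¹)) * z⁻¹ := by group
    _ = z⁻¹ * ((z * w * a' * b' * a'⁻¹ * b'⁻¹ * w⁻¹)) := by rw [hz']
    _ = w * (a' * b' * a'⁻¹ * b'⁻¹) * w⁻¹ := by group
    _ = a' * b' * a'⁻¹ * b'⁻¹ := by rw [← hw]; group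

variable (p : E →* G) (hp : Function.Surjective p) (hc : p.ker ≤ Subgroup.center E)

/-- A central extension `p : E → G` induces a homomorphism from the tensor square of `G` to `E`
which sends `p a ⊗ p b` to `⁅a, b⁆`. -/
noncomputable def liftCentral : TensorSquare G →* E :=
  lift (fun g h => ⁅Function.surjInv hp g, Function.surjInv hp h⁆)
    (fun g₁ g h => by
      set σ := Function.surjInv hp
      have hσ : ∀ g, p (σ g) = g := Function.surjInv_eq hp
      rw [commutatorElement_congr p hc (a' := σ g₁ * σ g) (b' := σ h) (by simp [hσ]) rfl,
        commutatorElement_congr p hc (a := σ (g₁ * g * g₁⁻¹)) (a' := σ g₁ * σ g * (σ g₁)⁻¹)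
          (b' := σ g₁ * σ h * (σ g₁)⁻¹) (by simp [hσ]) (by simp [hσ])]
      simp only [commutatorElement_def]; group)
    (fun g h₁ h => by
      set σ := Function.surjInv hp
      have hσ : ∀ g, p (σ g) = g := Function.surjInv_eq hp
      rw [commutatorElement_congr p hc (a' := σ g) (b' := σ h₁ * σ h) rfl (by simp [hσ]),
        commutatorElement_congr p hc (a := σ (h₁ * g * h₁⁻¹)) (a' := σ h₁ * σ g * (σ h₁)⁻¹)
          (b' := σ h₁ * σ h * (σ h₁)⁻¹) (by simp [hσ]) (by simp [hσ])]
      simp only [commutatorElement_def]; group)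

theorem liftCentral_tmul (a b : E) : liftCentral p hp hc (p a ⊗ₙ p b) = ⁅a, b⁆ :=
  (lift_tmul _ _ _ _ _).trans <|
    commutatorElement_congr p hc (Function.surjInv_eq hp _) (Function.surjInv_eq hp _)

theorem map_liftCentral (τ : TensorSquare G) : p (liftCentral p hp hc τ) = toCommutator τ := by
  have : p.comp (liftCentral p hp hc) = toCommutator := hom_ext fun a b => by
    obtain ⟨a, rfl⟩ := hp a
    obtain ⟨b, rfl⟩ := hp b
    simp [liftCentral_tmul, map_commutatorElement]
  exact DFunLike.congr_fun this τ

theorem commutator_le_range_liftCentral : commutator E ≤ (liftCentral p hp hc).range :=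
  Subgroup.commutator_le.2 fun a _ b _ => ⟨p a ⊗ₙ p b, liftCentral_tmul p hp hc a b⟩

end central

end TensorSquare

/-! ### Splitting off a central cyclic factor -/

open scoped commutatorElement TensorSquare
open TensorSquare

/-- The homomorphism from `ℤ/n` which sends the generator to an element `c` with `c ^ n = 1`. -/
def zmodPowHom {K : Type*} [Group K] (n : ℕ) (c : K) (hc : c ^ n = 1) :
    Multiplicative (ZMod n) →* K :=
  AddMonoidHom.toMultiplicativeLeft
    (ZMod.lift n ⟨zmultiplesHom (Additive K) (Additive.ofMul c), by
      simpa [← ofMul_pow] using congrArg Additive.ofMul hc⟩)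

theorem zmodPowHom_intCast {K : Type*} [Group K] {n : ℕ} {c : K} (hc : c ^ n = 1) (k : ℤ) :
    zmodPowHom n c hc (Multiplicative.ofAdd (k : ZMod n)) = c ^ k := by
  simp [zmodPowHom]

theorem exists_zpow_eq_zmodPowHom {K : Type*} [Group K] {n : ℕ} {c : K} (hc : c ^ n = 1)
    (a : Multiplicative (ZMod n)) : ∃ k : ℤ, zmodPowHom n c hc a = c ^ k := by
  obtain ⟨k, hk⟩ := ZMod.intCast_surjective a.toAdd
  exact ⟨k, by rw [← zmodPowHom_intCast hc, hk]; rfl⟩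

theorem comp_zmodPowHom {K : Type*} [Group K] {n : ℕ} {c : K} (hc : c ^ n = 1)
    (χ : K →* Multiplicative (ZMod n)) (h : χ c = Multiplicative.ofAdd 1)
    (a : Multiplicative (ZMod n)) : χ (zmodPowHom n c hc a) = a := by
  obtain ⟨k, hk⟩ := ZMod.intCast_surjective a.toAdd
  have ha : a = Multiplicative.ofAdd (k : ZMod n) := by rw [hk]; rfl
  rw [ha, zmodPowHom_intCast hc, map_zpow, h, ← ofAdd_zsmul, zsmul_one]

/-- A homomorphism that is split by a central section is a projection of a direct product. -/
def MonoidHom.mulEquivProdKer {K A : Type*} [Group K] [Group A] (χ : K →* A) (γ : A →* K)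
    (h : ∀ a, χ (γ a) = a) (hγ : ∀ a, γ a ∈ Subgroup.center K) : K ≃* A × χ.ker where
  toFun x := (χ x, ⟨(γ (χ x))⁻¹ * x, by simp [MonoidHom.mem_ker, h]⟩)
  invFun y := γ y.1 * y.2
  left_inv x := by simp
  right_inv y := by
    have hy : χ y.2 = 1 := y.2.2
    ext <;> simp [h, hy]
  map_mul' x y := by
    have := Subgroup.mem_center_iff.1 ((Subgroup.center K).inv_mem (hγ (χ y)))
    ext
    · simp
    · simp only [map_mul, mul_inv_rev, Prod.mk_mul_mk, Subgroup.coe_mul]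
      rw [mul_assoc _ x, ← mul_assoc x, this x]
      simp only [← mul_assoc]
      rw [this (γ (χ x))⁻¹]

/-- The commutator subgroup of `G` is abelian, and `s` maps to a generator of the cyclic
abelianization, which `π` identifies with `ℤ/n`. -/
structure IsMetabelianGenerator {G : Type*} [Group G] {n : ℕ} (π : G →* Multiplicative (ZMod n))
    (s : G) : Prop where
  comm : ∀ v ∈ commutator G, ∀ w ∈ commutator G, v * w = w * v
  ker_eq : π.ker = commutator G
  map_gen : π s = Multiplicative.ofAdd 1

/-! ### Metabelian groups with cyclic abelianization -/

namespace IsMetabelianGenerator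

variable {G : Type u} [Group G] {n : ℕ} {π : G →* Multiplicative (ZMod n)} {s : G}

theorem conj_mem {v : G} (hv : v ∈ commutator G) (g : G) : g * v * g⁻¹ ∈ commutator G :=
  Subgroup.Normal.conj_mem inferInstance v hv g

theorem commutatorElement_mem (a b : G) : ⁅a, b⁆ ∈ commutator G :=
  Subgroup.commutator_mem_commutator (Subgroup.mem_top _) (Subgroup.mem_top _)

theorem exists_eq_mul_zpow (h : IsMetabelianGenerator π s) (g : G) :
    ∃ v ∈ commutator G, ∃ k : ℤ, g = v * s ^ k := by
  obtain ⟨k, hk⟩ := ZMod.intCast_surjective (π g).toAdd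
  refine ⟨g * (s ^ k)⁻¹, ?_, k, by group⟩
  rw [← h.ker_eq, MonoidHom.mem_ker, map_mul, map_inv, map_zpow, h.map_gen, ← ofAdd_zsmul,
    zsmul_one, hk]
  simp

theorem closure_eq_top (h : IsMetabelianGenerator π s) :
    Subgroup.closure ((commutator G : Set G) ∪ {s}) = ⊤ := by
  refine (Subgroup.eq_top_iff' _).2 fun g => ?_
  obtain ⟨v, hv, k, rfl⟩ := h.exists_eq_mul_zpow g
  have hs : s ∈ (commutator G : Set G) ∪ {s} := Or.inr rfl
  have hv' : v ∈ (commutator G : Set G) ∪ {s} := Or.inl hv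
  exact mul_mem (Subgroup.subset_closure hv') (zpow_mem (Subgroup.subset_closure hs) k)

theorem commutatorElement_mul_gen (h : IsMetabelianGenerator π s) {v w : G}
    (hv : v ∈ commutator G) : ⁅v * w, s⁆ = ⁅v, s⁆ * ⁅w, s⁆ := by
  have e : ⁅v * w, s⁆ = v * ⁅w, s⁆ * v⁻¹ * ⁅v, s⁆ := by
    simp only [commutatorElement_def]; group
  rw [e, h.comm v hv _ (commutatorElement_mem w s), mul_inv_cancel_right,
    h.comm _ (commutatorElement_mem w s) _ (commutatorElement_mem v s)]

theorem conj_zpow_commutatorElement (v : G) (k : ℤ) :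
    s ^ k * ⁅v, s⁆ * (s ^ k)⁻¹ = ⁅s ^ k * v * (s ^ k)⁻¹, s⁆ := by
  have e : s ^ k * s * (s ^ k)⁻¹ = s := by group
  conv_rhs => rw [← e]
  simp only [commutatorElement_def]; group

/-- The values ⁅v, s⁆ form a subgroup, because v ↦ ⁅v, s⁆ is multiplicative on the abelian group G'.
It is normal and contains the commutators of the generators G' ∪ {s}, hence all of G'. -/
theorem exists_commutatorElement_eq (h : IsMetabelianGenerator π s) {u : G}
    (hu : u ∈ commutator G) : ∃ v ∈ commutator G, ⁅v, s⁆ = u := by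
  let D₀ : Subgroup G :=
    { carrier := {u | ∃ v ∈ commutator G, ⁅v, s⁆ = u}
      one_mem' := ⟨1, one_mem _, by simp⟩
      mul_mem' := by
        rintro _ _ ⟨v, hv, rfl⟩ ⟨w, hw, rfl⟩
        exact ⟨v * w, mul_mem hv hw, h.commutatorElement_mul_gen hv⟩
      inv_mem' := by
        rintro _ ⟨v, hv, rfl⟩
        refine ⟨v⁻¹, inv_mem hv, ?_⟩
        rw [eq_inv_iff_mul_eq_one, ← h.commutatorElement_mul_gen (inv_mem hv)]
        simp }
  -- As G' is the image of κ, generation of the tensor square by G-translates of generating symbols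
  -- replaces a direct commutator calculation.
  have key : D₀.comap toCommutator = ⊤ := by
    refine eq_top_of_closure (fun g τ hτ => ?_) h.closure_eq_top fun x hx y hy => ?_
    · obtain ⟨v, hv, hv'⟩ := hτ
      obtain ⟨w, hw, k, rfl⟩ := h.exists_eq_mul_zpow g
      refine ⟨s ^ k * v * (s ^ k)⁻¹, conj_mem hv _, ?_⟩
      rw [toCommutator_act, ← hv', ← conj_zpow_commutatorElement]
      have := h.comm w hw _ (conj_mem (commutatorElement_mem v s) (s ^ k))
      rw [mul_inv_rev, ← mul_inv_eq_iff_eq_mul.2 this]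
      group
    · rw [Subgroup.mem_comap, toCommutator_tmul]
      rcases hx with hx | rfl
      · rcases hy with hy | rfl
        · rw [commutatorElement_eq_one_iff_mul_comm.2 (h.comm x hx y hy)]
          exact one_mem _
        · exact ⟨x, hx, rfl⟩
      · rcases hy with hy | rfl
        · rw [← commutatorElement_inv]
          exact inv_mem ⟨y, hy, rfl⟩
        · rw [commutatorElement_self]
          exact one_mem _
  rw [← range_toCommutator] at hu
  obtain ⟨τ, rfl⟩ := hu
  exact (key ▸ Subgroup.mem_top τ : τ ∈ D₀.comap toCommutator)

/-- A surjective self-map of the finite set G' is injective. -/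
theorem eq_one_of_commutatorElement [Finite G] (h : IsMetabelianGenerator π s) {v : G}
    (hv : v ∈ commutator G) (hs : ⁅v, s⁆ = 1) : v = 1 := by
  let δ : commutator G → commutator G := fun v => ⟨⁅(v : G), s⁆, commutatorElement_mem _ _⟩
  have hδ : Function.Injective δ := Finite.injective_iff_surjective.2 fun u => by
    obtain ⟨v, hv, hu⟩ := h.exists_commutatorElement_eq u.2
    exact ⟨⟨v, hv⟩, Subtype.ext hu⟩
  have := @hδ ⟨v, hv⟩ 1 (Subtype.ext (by simp [δ, hs]))
  exact congrArg Subtype.val this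

/-- The power s ^ n lies in G' and commutes with s. Hence G splits as G' ⋊ ⟨s⟩. -/
theorem pow_eq_one [Finite G] (h : IsMetabelianGenerator π s) : s ^ n = 1 := by
  refine h.eq_one_of_commutatorElement ?_ ?_
  · rw [← h.ker_eq, MonoidHom.mem_ker, map_pow, h.map_gen, ← ofAdd_nsmul]
    simp
  · rw [commutatorElement_eq_one_iff_mul_comm]
    exact (Commute.pow_self s n).eq

/-! ### The alternating pairing on the derived subgroup -/

section pairing

variable (G) in
/-- The image of `G' ⊗ G'` in the tensor square of `G`. -/
def derivedSquare : Subgroup (TensorSquare G) :=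
  Subgroup.closure {τ | ∃ v ∈ commutator G, ∃ w ∈ commutator G, v ⊗ₙ w = τ}

theorem tmul_mem_derivedSquare {v w : G} (hv : v ∈ commutator G) (hw : w ∈ commutator G) :
    v ⊗ₙ w ∈ derivedSquare G :=
  Subgroup.subset_closure ⟨v, hv, w, hw, rfl⟩

/-- Elements of G' commute. Consequently G fixes these symbols, and the crossed relations become
bilinearity. -/
theorem derivedSquare_le_ker (h : IsMetabelianGenerator π s) :
    derivedSquare G ≤ (toCommutator (G := G)).ker := by
  refine (Subgroup.closure_le _).2 ?_
  rintro _ ⟨v, hv, w, hw, rfl⟩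
  rw [SetLike.mem_coe, MonoidHom.mem_ker, toCommutator_tmul, commutatorElement_eq_one_iff_mul_comm]
  exact h.comm v hv w hw

theorem act_derivedSquare (h : IsMetabelianGenerator π s) {v w : G} (hv : v ∈ commutator G)
    (hw : w ∈ commutator G) (g : G) : act g (v ⊗ₙ w) = v ⊗ₙ w :=
  act_eq_of_mem_ker (h.derivedSquare_le_ker (tmul_mem_derivedSquare hv hw)) g

theorem mul_tmul_derived (h : IsMetabelianGenerator π s) {v₁ v w : G} (hv : v ∈ commutator G)
    (hw : w ∈ commutator G) : (v₁ * v) ⊗ₙ w = (v ⊗ₙ w) * (v₁ ⊗ₙ w) := by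
  rw [mul_tmul', h.act_derivedSquare hv hw]

theorem tmul_mul_derived (h : IsMetabelianGenerator π s) {v w₁ w : G} (hv : v ∈ commutator G)
    (hw : w ∈ commutator G) : v ⊗ₙ (w₁ * w) = (v ⊗ₙ w₁) * (v ⊗ₙ w) := by
  rw [tmul_mul', h.act_derivedSquare hv hw]

theorem inv_tmul_derived (h : IsMetabelianGenerator π s) {v w : G} (hv : v ∈ commutator G)
    (hw : w ∈ commutator G) : v⁻¹ ⊗ₙ w = (v ⊗ₙ w)⁻¹ := by
  rw [inv_tmul, h.act_derivedSquare hv hw]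

theorem tmul_inv_derived (h : IsMetabelianGenerator π s) {v w : G} (hv : v ∈ commutator G)
    (hw : w ∈ commutator G) : v ⊗ₙ w⁻¹ = (v ⊗ₙ w)⁻¹ := by
  rw [tmul_inv, h.act_derivedSquare hv hw]

theorem pow_tmul_derived (h : IsMetabelianGenerator π s) {v w : G} (hv : v ∈ commutator G)
    (hw : w ∈ commutator G) (k : ℕ) : (v ^ k) ⊗ₙ w = (v ⊗ₙ w) ^ k := by
  induction k with
  | zero => simp
  | succ k ih => rw [pow_succ, h.mul_tmul_derived hv hw, ih, pow_succ']

theorem tmul_self_derived {v : G} (hv : v ∈ commutator G) : v ⊗ₙ v = 1 :=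
  tmul_self_of_mem_range (range_toCommutator (G := G) ▸ hv)

theorem tmul_swap_derived (h : IsMetabelianGenerator π s) {v w : G} (hv : v ∈ commutator G)
    (hw : w ∈ commutator G) : w ⊗ₙ v = (v ⊗ₙ w)⁻¹ := by
  have := tmul_self_derived (mul_mem hv hw)
  rw [h.mul_tmul_derived hw (mul_mem hv hw), h.tmul_mul_derived hv hw,
    h.tmul_mul_derived hw hw, tmul_self_derived hv, tmul_self_derived hw, one_mul, mul_one] at this
  exact eq_inv_of_mul_eq_one_left this

/-- An alternating bilinear pairing on a group with two generators is determined by its value on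
that pair. -/
theorem derivedSquare_le_zpowers (h : IsMetabelianGenerator π s) {e₁ e₂ : G}
    (he : commutator G = Subgroup.closure {e₁, e₂}) :
    derivedSquare G ≤ Subgroup.zpowers (e₁ ⊗ₙ e₂) := by
  have h₁ : e₁ ∈ commutator G := he ▸ Subgroup.subset_closure (Or.inl rfl)
  have h₂ : e₂ ∈ commutator G := he ▸ Subgroup.subset_closure (Or.inr rfl)
  set K := Subgroup.zpowers (e₁ ⊗ₙ e₂)
  have hgen : ∀ x ∈ ({e₁, e₂} : Set G), ∀ y ∈ ({e₁, e₂} : Set G), x ⊗ₙ y ∈ K := by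
    rintro x (rfl | rfl) y (rfl | rfl)
    · rw [tmul_self_derived h₁]; exact one_mem _
    · exact Subgroup.mem_zpowers _
    · rw [h.tmul_swap_derived h₁ h₂]; exact inv_mem (Subgroup.mem_zpowers _)
    · rw [tmul_self_derived h₂]; exact one_mem _
  have hx (y : G) (hy : y ∈ ({e₁, e₂} : Set G)) (v : G) (hv : v ∈ commutator G) :
      v ⊗ₙ y ∈ K := by
    have hyD : y ∈ commutator G := he ▸ Subgroup.subset_closure hy
    rw [he] at hv
    induction hv using Subgroup.closure_induction with
    | mem x hx => exact hgen x hx y hy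
    | one => rw [one_tmul]; exact one_mem _
    | mul a b _ hb iha ihb => rw [h.mul_tmul_derived (he ▸ hb) hyD]; exact mul_mem ihb iha
    | inv a ha iha => rw [h.inv_tmul_derived (he ▸ ha) hyD]; exact inv_mem iha
  refine (Subgroup.closure_le _).2 ?_
  rintro _ ⟨v, hv, w, hw, rfl⟩
  rw [he] at hw
  show v ⊗ₙ w ∈ K
  induction hw using Subgroup.closure_induction with
  | mem y hy => exact hx y hy v hv
  | one => rw [tmul_one]; exact one_mem _
  | mul a b _ hb iha ihb => rw [h.tmul_mul_derived hv (he ▸ hb)]; exact mul_mem iha ihb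
  | inv a ha iha => rw [h.tmul_inv_derived hv (he ▸ ha)]; exact inv_mem iha

end pairing

/-! ### Normal form of a tensor -/

section normalForm

theorem tmul_self_mem_ker (g : G) : g ⊗ₙ g ∈ (toCommutator (G := G)).ker := by
  rw [MonoidHom.mem_ker, toCommutator_tmul, commutatorElement_self]

theorem pow_tmul_self (g : G) (k : ℕ) : (g ^ k) ⊗ₙ g = (g ⊗ₙ g) ^ k := by
  induction k with
  | zero => simp
  | succ k ih => rw [pow_succ, mul_tmul', act_eq_of_mem_ker (tmul_self_mem_ker g), ih, pow_succ']

theorem tmul_self_pow_eq_one [Finite G] (h : IsMetabelianGenerator π s) :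
    (s ⊗ₙ s) ^ n = 1 := by
  rw [← pow_tmul_self, h.pow_eq_one, one_tmul]

theorem act_tmul_gen (v g : G) : act g (v ⊗ₙ s) = (g ⊗ₙ ⁅v, s⁆) * (v ⊗ₙ s) := by
  rw [← toCommutator_tmul, tmul_toCommutator, inv_mul_cancel_right]

/-- The subgroup N = Ω⟨s ⊗ s⟩ is central and fixed by G, and v ↦ v ⊗ s is multiplicative modulo N up
to order. So the products N · (v ⊗ s) form a G-stable subgroup, which contains the symbols of the
generators G' ∪ {s}. -/
theorem exists_eq_mul [Finite G] (h : IsMetabelianGenerator π s) (τ : TensorSquare G) :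
    ∃ ω ∈ derivedSquare G, ∃ k : ℤ, ∃ v ∈ commutator G, τ = ω * (s ⊗ₙ s) ^ k * (v ⊗ₙ s) := by
  set N := derivedSquare G ⊔ Subgroup.zpowers (s ⊗ₙ s) with hN
  have hΩN : derivedSquare G ≤ N := le_sup_left
  have hcN : s ⊗ₙ s ∈ N := (le_sup_right : _ ≤ N) (Subgroup.mem_zpowers _)
  have hNker : N ≤ toCommutator.ker :=
    sup_le h.derivedSquare_le_ker (Subgroup.zpowers_le.2 (tmul_self_mem_ker s))
  have hcen {x : TensorSquare G} (hx : x ∈ N) (y : TensorSquare G) : y * x = x * y :=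
    Subgroup.mem_center_iff.1 (ker_toCommutator_le_center (hNker hx)) y
  have hmul {v w : G} (hv : v ∈ commutator G) :
      (v * w) ⊗ₙ s = (v ⊗ₙ ⁅w, s⁆) * ((w ⊗ₙ s) * (v ⊗ₙ s)) := by
    rw [mul_tmul', act_tmul_gen, mul_assoc]
  have hmem {v : G} (hv : v ∈ commutator G) (w : G) : v ⊗ₙ ⁅w, s⁆ ∈ N :=
    hΩN (tmul_mem_derivedSquare hv (commutatorElement_mem _ _))
  let S : Subgroup (TensorSquare G) :=
    { carrier := {τ | ∃ v ∈ commutator G, ∃ y ∈ N, τ = y * (v ⊗ₙ s)}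
      one_mem' := ⟨1, one_mem _, 1, one_mem _, by simp⟩
      mul_mem' := by
        rintro _ _ ⟨v, hv, y, hy, rfl⟩ ⟨w, hw, z, hz, rfl⟩
        refine ⟨w * v, mul_mem hw hv, y * z * (w ⊗ₙ ⁅v, s⁆)⁻¹,
          mul_mem (mul_mem hy hz) (inv_mem (hmem hw v)), ?_⟩
        rw [hmul hw]
        calc y * (v ⊗ₙ s) * (z * (w ⊗ₙ s)) = y * ((v ⊗ₙ s) * z) * (w ⊗ₙ s) := by group
          _ = _ := by rw [hcen hz]; group
      inv_mem' := by
        rintro _ ⟨v, hv, y, hy, rfl⟩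
        refine ⟨v⁻¹, inv_mem hv, y⁻¹ * (v ⊗ₙ ⁅v⁻¹, s⁆),
          mul_mem (inv_mem hy) (hmem hv _), ?_⟩
        have h₁ := hmul (w := v⁻¹) hv
        rw [mul_inv_cancel, one_tmul] at h₁
        have h₂ : (v ⊗ₙ s)⁻¹ = (v ⊗ₙ ⁅v⁻¹, s⁆) * (v⁻¹ ⊗ₙ s) := by
          rw [← mul_assoc] at h₁
          exact (eq_inv_of_mul_eq_one_left h₁.symm).symm
        rw [mul_inv_rev, hcen (inv_mem hy), h₂, mul_assoc] }
  have hφ {v : G} (hv : v ∈ commutator G) : v ⊗ₙ s ∈ S := ⟨v, hv, 1, one_mem _, by simp⟩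
  have hNS : N ≤ S := fun y hy => ⟨1, one_mem _, y, hy, by simp⟩
  have hS : S = ⊤ := by
    refine eq_top_of_closure ?_ h.closure_eq_top ?_
    · rintro g _ ⟨v, hv, y, hy, rfl⟩
      obtain ⟨w, hw, k, rfl⟩ := h.exists_eq_mul_zpow g
      rw [map_mul, act_eq_of_mem_ker (hNker hy), act_mul]
      refine mul_mem (hNS hy) ?_
      rw [act_tmul (s ^ k), show s ^ k * s * (s ^ k)⁻¹ = s by group, act_tmul_gen]
      exact mul_mem (hNS (hmem hw _)) (hφ (conj_mem hv _))
    · rintro x (hx | rfl) y (hy | rfl)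
      · exact hNS (hΩN (tmul_mem_derivedSquare hx hy))
      · exact hφ hx
      · obtain ⟨v, hv, rfl⟩ := h.exists_commutatorElement_eq hy
        -- Here x is s. For any τ, the symbols x ⊗ κτ and κτ ⊗ x are inverse to each other.
        have : x ⊗ₙ ⁅v, x⁆ = ((⁅v, x⁆) ⊗ₙ x)⁻¹ := by
          rw [← toCommutator_tmul, tmul_toCommutator, toCommutator_tmul_right]; group
        rw [this]
        exact inv_mem (hφ hy)
      · exact hNS hcN
  obtain ⟨v, hv, y, hy, rfl⟩ := (hS ▸ Subgroup.mem_top τ : τ ∈ S)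
  have hnormal : (derivedSquare G).Normal := ⟨fun ω hω g => by
    rw [hcen (hΩN hω), mul_inv_cancel_right]; exact hω⟩
  obtain ⟨ω, hω, _, ⟨k, rfl⟩, rfl⟩ := Subgroup.mem_sup_of_normal_left.1 hy
  exact ⟨ω, hω, k, v, hv, rfl⟩

/-- Applying κ to the normal form leaves ⁅v, s⁆ = 1, so v = 1. -/
theorem exists_eq_mul_of_mem_ker [Finite G] (h : IsMetabelianGenerator π s) {τ : TensorSquare G}
    (hτ : τ ∈ (toCommutator (G := G)).ker) :
    ∃ ω ∈ derivedSquare G, ∃ k : ℤ, τ = ω * (s ⊗ₙ s) ^ k := by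
  obtain ⟨ω, hω, k, v, hv, rfl⟩ := h.exists_eq_mul τ
  refine ⟨ω, hω, k, ?_⟩
  have h₁ := MonoidHom.mem_ker.1 (h.derivedSquare_le_ker hω)
  have h₂ := MonoidHom.mem_ker.1 (tmul_self_mem_ker s)
  rw [MonoidHom.mem_ker, map_mul, map_mul, map_zpow, h₁, h₂, one_zpow, one_mul, one_mul,
    toCommutator_tmul] at hτ
  rw [h.eq_one_of_commutatorElement hv hτ, one_tmul, mul_one]

end normalForm

/-! ### The direct factor from the abelianization -/

section abelianizationPairing

/-- The homomorphism `g ⊗ h ↦ π g * π h` into the ring `ℤ/n`. -/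
def _root_.TensorSquare.pairing (π : G →* Multiplicative (ZMod n)) :
    TensorSquare G →* Multiplicative (ZMod n) :=
  lift (fun g h => Multiplicative.ofAdd ((π g).toAdd * (π h).toAdd))
    (fun g₁ g h => by
      simp only [map_mul, map_inv, toAdd_mul, toAdd_inv, ← ofAdd_add]; congr 1; ring)
    (fun g h₁ h => by
      simp only [map_mul, map_inv, toAdd_mul, toAdd_inv, ← ofAdd_add]; congr 1; ring)

@[simp]
theorem _root_.TensorSquare.pairing_tmul (g h : G) :
    pairing π (g ⊗ₙ h) = Multiplicative.ofAdd ((π g).toAdd * (π h).toAdd) :=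
  lift_tmul _ _ _ _ _

theorem pairing_tmul_self (h : IsMetabelianGenerator π s) :
    pairing π (s ⊗ₙ s) = Multiplicative.ofAdd 1 := by
  simp [h.map_gen]

theorem derivedSquare_le_ker_pairing (h : IsMetabelianGenerator π s) :
    derivedSquare G ≤ (pairing π).ker := by
  refine (Subgroup.closure_le _).2 ?_
  rintro _ ⟨v, hv, w, hw, rfl⟩
  rw [← h.ker_eq, MonoidHom.mem_ker] at hv
  simp [MonoidHom.mem_ker, hv]

theorem ker_inf_ker [Finite G] (h : IsMetabelianGenerator π s) :
    (pairing π).ker ⊓ toCommutator.ker = derivedSquare G := by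
  refine le_antisymm ?_ (le_inf h.derivedSquare_le_ker_pairing h.derivedSquare_le_ker)
  intro τ hτ
  obtain ⟨h₁, h₂⟩ := Subgroup.mem_inf.1 hτ
  obtain ⟨ω, hω, k, rfl⟩ := h.exists_eq_mul_of_mem_ker h₂
  -- On ω (s ⊗ s)^k the pairing reads off k modulo n, and (s ⊗ s)^n = 1.
  have h₃ := comp_zmodPowHom h.tmul_self_pow_eq_one (pairing π) h.pairing_tmul_self
    (Multiplicative.ofAdd (k : ZMod n))
  rw [zmodPowHom_intCast] at h₃
  rw [MonoidHom.mem_ker, map_mul,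
    MonoidHom.mem_ker.1 (h.derivedSquare_le_ker_pairing hω), one_mul, h₃] at h₁
  rw [← zmodPowHom_intCast h.tmul_self_pow_eq_one, h₁, map_one, mul_one]
  exact hω

/-- If the abelianization is `ℤ/n`, then the tensor square has a direct factor `ℤ/n`. -/
theorem nonempty_mulEquiv_prod_ker [Finite G] (h : IsMetabelianGenerator π s) :
    Nonempty (TensorSquare G ≃* Multiplicative (ZMod n) × (pairing π).ker) :=
  ⟨(pairing π).mulEquivProdKer (zmodPowHom n (s ⊗ₙ s) h.tmul_self_pow_eq_one)
    (comp_zmodPowHom _ _ h.pairing_tmul_self) fun a => by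
      obtain ⟨k, hk⟩ := exists_zpow_eq_zmodPowHom h.tmul_self_pow_eq_one a
      rw [hk]
      exact zpow_mem (ker_toCommutator_le_center (tmul_self_mem_ker s)) k⟩

variable (π) in
/-- The commutator homomorphism on the kernel of `pairing π`, with values in `G'`. -/
def kerToCommutator : (pairing π).ker →* commutator G :=
  (toCommutator.comp (pairing π).ker.subtype).codRestrict (commutator G) fun τ =>
    range_toCommutator (G := G) ▸ ⟨τ, rfl⟩

theorem coe_kerToCommutator (τ : (pairing π).ker) :
    (kerToCommutator π τ : G) = toCommutator (τ : TensorSquare G) := rfl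

/-- The tensors v ⊗ s with v in G' suffice, since every element of G' is some ⁅v, s⁆. -/
theorem kerToCommutator_surjective (h : IsMetabelianGenerator π s) :
    Function.Surjective (kerToCommutator π) := fun u => by
  obtain ⟨v, hv, hu⟩ := h.exists_commutatorElement_eq u.2
  refine ⟨⟨v ⊗ₙ s, ?_⟩, Subtype.ext ?_⟩
  · rw [← h.ker_eq, MonoidHom.mem_ker] at hv
    simp [MonoidHom.mem_ker, hv]
  · rw [coe_kerToCommutator, toCommutator_tmul, hu]

theorem mem_ker_kerToCommutator [Finite G] (h : IsMetabelianGenerator π s)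
    (τ : (pairing π).ker) :
    τ ∈ (kerToCommutator π).ker ↔ (τ : TensorSquare G) ∈ derivedSquare G := by
  rw [← h.ker_inf_ker, Subgroup.mem_inf, MonoidHom.mem_ker, ← Subtype.coe_inj,
    coe_kerToCommutator, Subgroup.coe_one, MonoidHom.mem_ker (f := toCommutator)]
  exact ⟨fun e => ⟨τ.2, e⟩, fun e => e.2⟩

theorem nonempty_mulEquiv_of_derivedSquare_eq_bot [Finite G] (h : IsMetabelianGenerator π s)
    (hΩ : derivedSquare G = ⊥) :
    Nonempty (TensorSquare G ≃* Multiplicative (ZMod n) × commutator G) := by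
  obtain ⟨e⟩ := h.nonempty_mulEquiv_prod_ker
  refine ⟨e.trans (MulEquiv.prodCongr (MulEquiv.refl _)
    (MulEquiv.ofBijective (kerToCommutator π) ⟨?_, h.kerToCommutator_surjective⟩))⟩
  rw [← MonoidHom.ker_eq_bot_iff, eq_bot_iff]
  intro τ hτ
  rw [h.mem_ker_kerToCommutator, hΩ, Subgroup.mem_bot] at hτ
  exact Subgroup.mem_bot.2 (Subtype.ext hτ)

end abelianizationPairing

end IsMetabelianGenerator

/-! ### Central extensions from 2-cocycles -/

open scoped IsMulCommutative

/-- A 2-cocycle on `G` with values in the trivial module `A`. -/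
structure TrivialTwoCocycle (G A : Type*) [Group G] [AddCommGroup A] where
  /-- The underlying function. -/
  toFun : G → G → A
  cocycle' : ∀ g h j, toFun g h + toFun (g * h) j = toFun h j + toFun g (h * j)

namespace TrivialTwoCocycle

section extension

variable {G A : Type*} [Group G] [AddCommGroup A] (f : TrivialTwoCocycle G A)

theorem map_one_left (g : G) : f.toFun 1 g = f.toFun 1 1 := by
  simpa using (f.cocycle' 1 1 g).symm

theorem map_one_right (g : G) : f.toFun g 1 = f.toFun 1 1 := by
  simpa using f.cocycle' g 1 1

/-- The central extension of `G` by `A` with cocycle `f`. -/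
@[ext]
structure Extension (f : TrivialTwoCocycle G A) where
  /-- The component in `A`. -/
  fst : A
  /-- The component in `G`. -/
  snd : G

namespace Extension

variable {f}

instance : Mul f.Extension := ⟨fun x y => ⟨x.fst + y.fst + f.toFun x.snd y.snd, x.snd * y.snd⟩⟩
-- Cocycles are not assumed normalized, hence the corrections by `f.toFun 1 1`.
instance : One f.Extension := ⟨⟨-f.toFun 1 1, 1⟩⟩
instance : Inv f.Extension :=
  ⟨fun x => ⟨-x.fst - f.toFun x.snd⁻¹ x.snd - f.toFun 1 1, x.snd⁻¹⟩⟩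

theorem mul_def (x y : f.Extension) :
    x * y = ⟨x.fst + y.fst + f.toFun x.snd y.snd, x.snd * y.snd⟩ := rfl

theorem one_def : (1 : f.Extension) = ⟨-f.toFun 1 1, 1⟩ := rfl

theorem inv_def (x : f.Extension) :
    x⁻¹ = ⟨-x.fst - f.toFun x.snd⁻¹ x.snd - f.toFun 1 1, x.snd⁻¹⟩ := rfl

instance : Group f.Extension := Group.ofLeftAxioms
  (fun x y z => by
    have := f.cocycle' x.snd y.snd z.snd
    ext
    · simp only [mul_def]
      rw [add_right_comm (x.fst + y.fst), add_assoc (x.fst + y.fst + z.fst), this]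
      abel
    · simp [mul_def, mul_assoc])
  (fun x => by ext <;> simp [mul_def, one_def, map_one_left])
  (fun x => by
    ext
    · simp only [mul_def, one_def, inv_def]; abel
    · simp [mul_def, one_def, inv_def])

variable (f) in
/-- The projection of the extension onto `G`. -/
def proj : f.Extension →* G where
  toFun := snd
  map_one' := rfl
  map_mul' _ _ := rfl

@[simp] theorem proj_apply (x : f.Extension) : proj f x = x.snd := rfl

theorem proj_surjective : Function.Surjective (proj f) := fun g => ⟨⟨0, g⟩, rfl⟩

variable (f) in
/-- The inclusion of `A` into the extension. -/
def incl : Multiplicative A →* f.Extension where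
  toFun a := ⟨a.toAdd - f.toFun 1 1, 1⟩
  map_one' := by ext <;> simp [one_def]
  map_mul' a b := by
    ext
    · simp only [mul_def, toAdd_mul]; abel
    · simp [mul_def]

theorem incl_apply (a : Multiplicative A) : incl f a = ⟨a.toAdd - f.toFun 1 1, 1⟩ := rfl

@[simp] theorem snd_incl (a : Multiplicative A) : (incl f a).snd = 1 := rfl

theorem incl_injective : Function.Injective (incl f) := fun a b h => by
  have := congrArg fst h
  simpa [incl_apply] using this

theorem incl_mul (a : Multiplicative A) (x : f.Extension) :
    incl f a * x = ⟨a.toAdd + x.fst, x.snd⟩ := by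
  ext
  · simp only [mul_def, incl_apply, map_one_left]; abel
  · simp [mul_def, incl_apply]

theorem ker_proj_le_center : (proj f).ker ≤ Subgroup.center f.Extension := fun x hx =>
  Subgroup.mem_center_iff.2 fun y => by
    have hx : x.snd = 1 := hx
    ext
    · simp only [mul_def, hx, map_one_left, map_one_right]; abel
    · simp [mul_def, hx]

theorem mk_mul_mk (g h : G) : (⟨0, g⟩ : f.Extension) * ⟨0, h⟩ =
    incl f (Multiplicative.ofAdd (f.toFun g h)) * ⟨0, g * h⟩ := by
  rw [incl_mul]
  ext <;> simp [mul_def]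

end Extension

end extension

/-! ### The universal cocycle and second homology -/

section homology

variable {G : Type u} {B : Type*} [AddCommGroup B]

/-- The 2-chains of `G` with integral coefficients. -/
abbrev _root_.IntegralTwoChains (G : Type u) : Type u := G × G →₀ ULift.{u} ℤ

/-- The trivial integral representation. -/
noncomputable abbrev _root_.trivialIntRep (G : Type u) [Group G] : Rep.{u} (ULift.{u} ℤ) G :=
  Rep.trivial (ULift.{u} ℤ) G (ULift.{u} ℤ)

/-- Evaluation of a function of two variables on 2-chains. -/
noncomputable def _root_.evalTwoChains (f : G → G → B) : IntegralTwoChains G →+ B :=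
  Finsupp.liftAddHom fun x => (zmultiplesHom B (f x.1 x.2)).comp AddEquiv.ulift.toAddMonoidHom

@[simp]
theorem _root_.evalTwoChains_single (f : G → G → B) (x : G × G) (r : ULift.{u} ℤ) :
    evalTwoChains f (Finsupp.single x r) = r.down • f x.1 x.2 := by
  simp only [evalTwoChains, Finsupp.liftAddHom_apply_single]
  rfl

variable [Group G]

theorem d₃₂_single_trivial (g h j : G) (r : ULift.{u} ℤ) :
    (groupHomology.d₃₂ (trivialIntRep G)).hom (Finsupp.single (g, h, j) r) =
      (Finsupp.single (h, j) r - Finsupp.single (g * h, j) r + Finsupp.single (g, h * j) r -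
        Finsupp.single (g, h) r : IntegralTwoChains G) :=
  groupHomology.d₃₂_single (A := trivialIntRep G) (g, h, j) r

theorem d₂₁_single_trivial (g h : G) (r : ULift.{u} ℤ) :
    (groupHomology.d₂₁ (trivialIntRep G)).hom (Finsupp.single (g, h) r) =
      (Finsupp.single h r - Finsupp.single (g * h) r + Finsupp.single g r : G →₀ ULift.{u} ℤ) :=
  groupHomology.d₂₁_single (A := trivialIntRep G) (g, h) r

/-- On the boundary of a basic 3-chain the evaluation is the cocycle identity. -/
theorem evalTwoChains_eq_zero (f : TrivialTwoCocycle G B) {z : IntegralTwoChains G}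
    (hz : z ∈ groupHomology.boundaries₂ (trivialIntRep G)) : evalTwoChains f.toFun z = 0 := by
  obtain ⟨y, rfl⟩ := hz
  have : (evalTwoChains f.toFun).comp
      (groupHomology.d₃₂ (trivialIntRep G)).hom.toAddMonoidHom = 0 := by
    refine Finsupp.addHom_ext fun x r => ?_
    obtain ⟨g, h, j⟩ := x
    have hf := f.cocycle' g h j
    refine (congrArg (evalTwoChains f.toFun) (d₃₂_single_trivial g h j r)).trans ?_
    simp only [map_sub, map_add, evalTwoChains_single, ← smul_sub, ← smul_add]
    rw [← eq_sub_iff_add_eq] at hf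
    rw [hf, AddMonoidHom.zero_apply]
    convert smul_zero r.down using 2
    abel
  exact DFunLike.congr_fun this y

variable (G) in
/-- The universal 2-cocycle, with values in the 2-chains modulo the boundaries. -/
noncomputable def universal : TrivialTwoCocycle G
    (IntegralTwoChains G ⧸ groupHomology.boundaries₂ (trivialIntRep G)) where
  toFun g h := Submodule.Quotient.mk (Finsupp.single (g, h) 1)
  cocycle' g h j := by
    rw [← Submodule.Quotient.mk_add, ← Submodule.Quotient.mk_add, eq_comm,
      Submodule.Quotient.eq]
    refine ⟨Finsupp.single (g, h, j) 1, (d₃₂_single_trivial g h j 1).trans ?_⟩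
    abel

variable (G) in
/-- The inclusion of 2-chains modulo boundaries into the universal extension. -/
noncomputable def chainsToExtension :
    Multiplicative (IntegralTwoChains G) →* (universal G).Extension :=
  (Extension.incl (universal G)).comp (AddMonoidHom.toMultiplicative
    (groupHomology.boundaries₂ (trivialIntRep G)).mkQ.toAddMonoidHom)

theorem chainsToExtension_apply (z : IntegralTwoChains G) :
    chainsToExtension G (Multiplicative.ofAdd z) =
      Extension.incl (universal G) (Multiplicative.ofAdd (Submodule.Quotient.mk z)) := rfl

theorem chainsToExtension_eq_one_iff (z : IntegralTwoChains G) :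
    chainsToExtension G (Multiplicative.ofAdd z) = 1 ↔
      z ∈ groupHomology.boundaries₂ (trivialIntRep G) := by
  rw [chainsToExtension_apply, ← map_one (Extension.incl (universal G)),
    Extension.incl_injective.eq_iff, ← ofAdd_zero, Multiplicative.ofAdd.injective.eq_iff,
    Submodule.Quotient.mk_eq_zero]

/-- In the abelianized extension, the product rule for the section g ↦ ⟨0, g⟩ sends the chain (g, h)
to x g + x h - x (gh). The map on chains thus factors through `d₂₁` and kills cycles. -/
theorem chainsToExtension_mem_commutator {z : IntegralTwoChains G}
    (hz : z ∈ groupHomology.cycles₂ (trivialIntRep G)) :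
    chainsToExtension G (Multiplicative.ofAdd z) ∈ commutator (universal G).Extension := by
  let E := (universal G).Extension
  let x (g : G) : Additive (Abelianization E) := Additive.ofMul (Abelianization.of ⟨0, g⟩)
  let θ : (G →₀ ULift.{u} ℤ) →+ Additive (Abelianization E) :=
    Finsupp.liftAddHom fun g => (zmultiplesHom _ (x g)).comp AddEquiv.ulift.toAddMonoidHom
  have hθ (g : G) (r : ULift.{u} ℤ) : θ (Finsupp.single g r) = r.down • x g := by
    simp only [θ, Finsupp.liftAddHom_apply_single]; rfl
  let F : IntegralTwoChains G →+ Additive (Abelianization E) :=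
    MonoidHom.toAdditiveRight (Abelianization.of.comp (chainsToExtension G))
  have hF (g h : G) : F (Finsupp.single (g, h) 1) = x g + x h - x (g * h) := by
    rw [eq_sub_iff_add_eq]
    change Additive.ofMul (Abelianization.of _) = Additive.ofMul (Abelianization.of (_ * _))
    rw [Extension.mk_mul_mk]
    rfl
  have key : F = θ.comp (groupHomology.d₂₁ (trivialIntRep G)).hom.toAddMonoidHom := by
    refine Finsupp.addHom_ext fun y r => ?_
    obtain ⟨g, h⟩ := y
    refine Eq.trans ?_ (congrArg θ (d₂₁_single_trivial g h r)).symm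
    have hr : (Finsupp.single (g, h) r : IntegralTwoChains G) =
        r.down • Finsupp.single (g, h) 1 := by
      rw [Finsupp.smul_single]; congr 1
      ext; simp
    rw [hr, map_zsmul, hF]
    simp only [map_add, map_sub, hθ, ← smul_sub, ← smul_add]
    congr 1
    abel
  have hz' : F z = 0 := by
    rw [key]
    exact (congrArg θ (LinearMap.mem_ker.1 hz)).trans (map_zero θ)
  rw [← Abelianization.ker_of, MonoidHom.mem_ker]
  exact hz'

theorem single_sub_single_mem_cycles₂ {v w : G} (hvw : v * w = w * v) :
    (Finsupp.single (v, w) 1 - Finsupp.single (w, v) 1 : IntegralTwoChains G) ∈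
      groupHomology.cycles₂ (trivialIntRep G) := by
  refine LinearMap.mem_ker.2 ((map_sub _ _ _).trans ?_)
  refine (congrArg₂ (· - ·) (d₂₁_single_trivial v w 1) (d₂₁_single_trivial w v 1)).trans ?_
  rw [hvw]
  abel

/-- If the Schur multiplier vanishes, then 2-cocycles are symmetric on commuting pairs. -/
theorem symm_of_subsingleton (f : TrivialTwoCocycle G B) [Subsingleton (SchurMultiplier G)]
    {v w : G} (hvw : v * w = w * v) : f.toFun v w = f.toFun w v := by
  -- The cycle (v, w) - (w, v) is a boundary, so f evaluates to zero on it.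
  have hz := single_sub_single_mem_cycles₂ hvw
  have := f.evalTwoChains_eq_zero <| (groupHomology.H2π_eq_zero_iff
    (⟨_, hz⟩ : groupHomology.cycles₂ (trivialIntRep G))).1 (Subsingleton.elim _ _)
  rw [map_sub, evalTwoChains_single, evalTwoChains_single, ULift.one_down, one_smul,
    one_smul] at this
  exact sub_eq_zero.1 this

end homology

end TrivialTwoCocycle

/-! ### The Schur multiplier against the derived square -/

namespace IsMetabelianGenerator

variable {G : Type u} [Group G] [Finite G] {n : ℕ} {π : G →* Multiplicative (ZMod n)} {s : G}

/-- In the universal extension E, cycles modulo boundaries form a copy of M(G) inside ker p ∩ [E,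
E]. Each element lifts through t to ker κ = Ω⟨s ⊗ s⟩, and t kills s ⊗ s, so M(G) lies in the image
of Ω. -/
theorem card_schurMultiplier_dvd (h : IsMetabelianGenerator π s) :
    Nat.card (SchurMultiplier G) ∣ Nat.card (derivedSquare G) := by
  let E := (TrivialTwoCocycle.universal G).Extension
  let p : E →* G := TrivialTwoCocycle.Extension.proj _
  let t : TensorSquare G →* E := liftCentral p TrivialTwoCocycle.Extension.proj_surjective
    TrivialTwoCocycle.Extension.ker_proj_le_center
  let Z := groupHomology.cycles₂ (trivialIntRep G)
  let ι : Multiplicative Z →* E := (TrivialTwoCocycle.chainsToExtension G).comp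
    (AddMonoidHom.toMultiplicative Z.subtype.toAddMonoidHom)
  let ρ : Multiplicative Z →* Multiplicative (SchurMultiplier G) :=
    AddMonoidHom.toMultiplicative
      (groupHomology.H2π (trivialIntRep G)).hom.toAddMonoidHom
  have hρ : Function.Surjective ρ := fun y =>
    groupHomology.H2_induction_on (C := fun y => ∃ x, ρ x = Multiplicative.ofAdd y) y.toAdd
      fun x => ⟨Multiplicative.ofAdd x, rfl⟩
  -- Both kernels consist of the boundaries, so the image of ι has the order of M(G).
  have hker : ρ.ker = ι.ker := by
    ext z
    rw [MonoidHom.mem_ker, MonoidHom.mem_ker]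
    exact (groupHomology.H2π_eq_zero_iff z.toAdd).trans
      (TrivialTwoCocycle.chainsToExtension_eq_one_iff (z.toAdd : IntegralTwoChains G)).symm
  have hcard : Nat.card (SchurMultiplier G) = Nat.card ι.range := by
    rw [← Subgroup.index_ker, ← hker, Subgroup.index_ker, MonoidHom.range_eq_top.2 hρ,
      Subgroup.card_top]
    rfl
  have hle : ι.range ≤ (derivedSquare G).map t := by
    rintro _ ⟨z, rfl⟩
    obtain ⟨τ, hτ⟩ := commutator_le_range_liftCentral p
      TrivialTwoCocycle.Extension.proj_surjective TrivialTwoCocycle.Extension.ker_proj_le_center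
      (TrivialTwoCocycle.chainsToExtension_mem_commutator z.toAdd.2)
    have hτ' : τ ∈ (toCommutator (G := G)).ker := by
      rw [MonoidHom.mem_ker, ← map_liftCentral p TrivialTwoCocycle.Extension.proj_surjective
        TrivialTwoCocycle.Extension.ker_proj_le_center, hτ]
      rfl
    obtain ⟨ω, hω, k, rfl⟩ := h.exists_eq_mul_of_mem_ker hτ'
    refine ⟨ω, hω, ?_⟩
    have hs : t (s ⊗ₙ s) = 1 := by
      have := liftCentral_tmul p TrivialTwoCocycle.Extension.proj_surjective
        TrivialTwoCocycle.Extension.ker_proj_le_center ⟨0, s⟩ ⟨0, s⟩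
      rwa [commutatorElement_self] at this
    refine Eq.trans ?_ hτ
    change _ = t _
    rw [map_mul, map_zpow, hs, one_zpow, mul_one]
  rw [hcard]
  exact (Subgroup.card_dvd_of_le hle).trans (Subgroup.card_map_dvd _ _)

/-- The component of `g` in the commutator subgroup. -/
noncomputable def derivedPart (h : IsMetabelianGenerator π s) (g : G) : G :=
  g * (zmodPowHom n s h.pow_eq_one (π g))⁻¹

theorem derivedPart_mem (h : IsMetabelianGenerator π s) (g : G) :
    h.derivedPart g ∈ commutator G := by
  rw [← h.ker_eq, MonoidHom.mem_ker, derivedPart, map_mul, map_inv,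
    comp_zmodPowHom _ _ h.map_gen, mul_inv_cancel]

theorem derivedPart_eq_self (h : IsMetabelianGenerator π s) {v : G} (hv : v ∈ commutator G) :
    h.derivedPart v = v := by
  rw [← h.ker_eq, MonoidHom.mem_ker] at hv
  rw [derivedPart, hv, map_one, inv_one, mul_one]

/-- The splitting makes `derivedPart` a crossed homomorphism G → G'; its cup square under the
G-invariant pairing is then a 2-cocycle. -/
theorem derivedPart_mul (h : IsMetabelianGenerator π s) (a b : G) :
    h.derivedPart (a * b) = h.derivedPart a * (a * h.derivedPart b * a⁻¹) := by
  rw [h.comm _ (h.derivedPart_mem a) _ (conj_mem (h.derivedPart_mem b) a)]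
  simp only [derivedPart, map_mul]
  group

/-- The central 2-cocycle given by the pairing of `G'` with itself in the tensor square. -/
noncomputable def cocycle (h : IsMetabelianGenerator π s) :
    TrivialTwoCocycle G (Additive (Subgroup.center (TensorSquare G))) where
  toFun a b := Additive.ofMul ⟨h.derivedPart a ⊗ₙ (a * h.derivedPart b * a⁻¹),
    ker_toCommutator_le_center (h.derivedSquare_le_ker
      (tmul_mem_derivedSquare (h.derivedPart_mem a) (conj_mem (h.derivedPart_mem b) a)))⟩
  cocycle' a b c := by
    have ha := h.derivedPart_mem a
    have hb := h.derivedPart_mem b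
    have hc := h.derivedPart_mem c
    have hb' := conj_mem hb a
    have hc' := conj_mem hc (a * b)
    -- Both entries may be conjugated by a, since G fixes symbols on G'.
    have e₁ : h.derivedPart b ⊗ₙ (b * h.derivedPart c * b⁻¹) =
        (a * h.derivedPart b * a⁻¹) ⊗ₙ (a * b * h.derivedPart c * (a * b)⁻¹) := by
      rw [← h.act_derivedSquare hb (conj_mem hc b) a, act_tmul]
      congr 1
      group
    have e₂ : a * h.derivedPart (b * c) * a⁻¹ =
        (a * h.derivedPart b * a⁻¹) * (a * b * h.derivedPart c * (a * b)⁻¹) := by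
      rw [h.derivedPart_mul]
      group
    refine congrArg Additive.ofMul (Subtype.ext ?_)
    change _ * (h.derivedPart (a * b) ⊗ₙ _) =
      (h.derivedPart b ⊗ₙ _) * (_ ⊗ₙ (a * h.derivedPart (b * c) * a⁻¹))
    rw [e₁, e₂, h.derivedPart_mul, h.mul_tmul_derived hb' hc', h.tmul_mul_derived ha hc',
      ← mul_assoc, ← mul_assoc]
    congr 1
    exact Subgroup.mem_center_iff.1 (ker_toCommutator_le_center (h.derivedSquare_le_ker
      (tmul_mem_derivedSquare hb' hc'))) _

/-- On G' the cocycle is the pairing itself. It is symmetric as M(G) = 0 and also alternating, so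
each value is its own inverse. -/
theorem tmul_sq_eq_one_of_subsingleton (h : IsMetabelianGenerator π s)
    [Subsingleton (SchurMultiplier G)] {v w : G} (hv : v ∈ commutator G)
    (hw : w ∈ commutator G) : (v ⊗ₙ w) ^ 2 = 1 := by
  have e := congrArg (fun x => ((Additive.toMul x : Subgroup.center _) : TensorSquare G))
    (h.cocycle.symm_of_subsingleton (h.comm v hv w hw))
  change h.derivedPart v ⊗ₙ (v * h.derivedPart w * v⁻¹) =
    h.derivedPart w ⊗ₙ (w * h.derivedPart v * w⁻¹) at e
  rw [h.derivedPart_eq_self hv, h.derivedPart_eq_self hw, h.comm v hv w hw, mul_inv_cancel_right,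
    ← h.comm v hv w hw, mul_inv_cancel_right, h.tmul_swap_derived hv hw] at e
  rw [sq]
  exact eq_inv_iff_mul_eq_one.1 e

end IsMetabelianGenerator

open IsMetabelianGenerator

/-! ### Groups of order pq² -/

section classification

theorem exists_isMetabelianGenerator {G : Type*} [Group G] {n : ℕ}
    (hcomm : ∀ v ∈ commutator G, ∀ w ∈ commutator G, v * w = w * v)
    (hcyc : IsCyclic (Abelianization G)) (hn : Nat.card (Abelianization G) = n) :
    ∃ (π : G →* Multiplicative (ZMod n)) (s : G), IsMetabelianGenerator π s := by
  subst hn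
  let e := zmodCyclicMulEquiv hcyc
  obtain ⟨s, hs⟩ := QuotientGroup.mk_surjective (e (Multiplicative.ofAdd 1))
  refine ⟨e.symm.toMonoidHom.comp Abelianization.of, s, hcomm, ?_, ?_⟩
  · ext g
    rw [← Abelianization.ker_of, MonoidHom.mem_ker, MonoidHom.mem_ker]
    simp
  · exact e.symm_apply_eq.2 hs

/-- Squarefree order makes the Sylow subgroups cyclic, and an abelian group with cyclic Sylow
subgroups is cyclic. -/
theorem isCyclic_of_card_eq_mul {A : Type*} [CommGroup A] {p q : ℕ} (hp : p.Prime)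
    (hq : q.Prime) (hpq : p ≠ q) (h : Nat.card A = p * q) : IsCyclic A := by
  have : Finite A := Nat.finite_of_card_ne_zero (h ▸ mul_ne_zero hp.ne_zero hq.ne_zero)
  have : IsZGroup A := IsZGroup.of_squarefree <| by
    rw [h, Nat.squarefree_mul ((Nat.coprime_primes hp hq).2 hpq)]
    exact ⟨hp.prime.squarefree, hq.prime.squarefree⟩
  infer_instance

theorem mul_comm_of_mulEquiv {G : Type*} [Group G] {A : Type*} [AddCommGroup A] {D : Subgroup G}
    (e : D ≃* Multiplicative A) : ∀ v ∈ D, ∀ w ∈ D, v * w = w * v := fun v hv w hw =>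
  congrArg Subtype.val (e.injective (by rw [map_mul, map_mul, mul_comm]) :
    (⟨v, hv⟩ * ⟨w, hw⟩ : D) = ⟨w, hw⟩ * ⟨v, hv⟩)

theorem pow_eq_one_of_mulEquiv {A : Type*} [Group A] {q : ℕ}
    (e : A ≃* Multiplicative (ZMod q × ZMod q)) (x : A) : x ^ q = 1 := by
  apply e.injective
  rw [map_pow, map_one, ← ofAdd_toAdd (e x), ← ofAdd_nsmul, ← Nat.cast_smul_eq_nsmul (ZMod q)]
  simp

theorem nonempty_mulEquiv_zmod_of_card {A : Type*} [Group A] {n : ℕ} (hA : IsCyclic A)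
    (h : Nat.card A = n) : Nonempty (A ≃* Multiplicative (ZMod n)) := by
  subst h
  exact ⟨(zmodCyclicMulEquiv hA).symm⟩

/-- A noncyclic group of order q² has exponent q and is abelian, hence is a plane over 𝔽_q. -/
theorem nonempty_mulEquiv_of_card_eq_sq {A : Type*} [Group A] {q : ℕ} (hq : q.Prime)
    (h : Nat.card A = q ^ 2) : Nonempty (A ≃* Multiplicative (ZMod (q ^ 2))) ∨
      Nonempty (A ≃* Multiplicative (ZMod q × ZMod q)) := by
  have := Fact.mk hq
  have : Finite A := Nat.finite_of_card_ne_zero (h ▸ pow_ne_zero 2 hq.ne_zero)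
  by_cases hA : IsCyclic A
  · exact Or.inl (nonempty_mulEquiv_zmod_of_card hA h)
  · right
    have hpow (x : A) : x ^ q = 1 := by
      obtain ⟨k, hk, hx⟩ := (Nat.dvd_prime_pow hq).1 (h ▸ orderOf_dvd_natCard x)
      have hk2 : k ≠ 2 := fun e => hA (isCyclic_of_orderOf_eq_card x (by rw [hx, e, h]))
      have hk1 : k ≤ 1 := by omega
      exact orderOf_dvd_iff_pow_eq_one.1 (hx ▸ (pow_dvd_pow q hk1).trans (pow_one q).dvd)
    let _ : CommGroup A := IsPGroup.commGroupOfCardEqPrimeSq h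
    let _ : Module (ZMod q) (Additive A) := AddCommGroup.zmodModule (n := q) fun x => hpow x.toMul
    have : Finite (Additive A) := ‹Finite A›
    have hfin : Module.finrank (ZMod q) (Additive A) = 2 := by
      have h₁ := Module.natCard_eq_pow_finrank (K := ZMod q) (V := Additive A)
      rw [Nat.card_zmod, show Nat.card (Additive A) = Nat.card A from rfl, h] at h₁
      exact (Nat.pow_right_injective hq.two_le h₁).symm
    have e : Additive A ≃ₗ[ZMod q] ZMod q × ZMod q :=
      LinearEquiv.ofFinrankEq _ _ (by rw [hfin]; simp)
    exact ⟨AddEquiv.toMultiplicativeRight e.toAddEquiv⟩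

/-- A subgroup of order q² has index p, the least prime divisor of the order, so it is normal. Its
quotient is cyclic, so it contains G'. -/
theorem card_commutator_of_card_eq {G : Type*} [Group G] {p q : ℕ} (hp : p.Prime) (hq : q.Prime)
    (hpq : p < q) (hcard : Nat.card G = p * q ^ 2) (hnonab : ∃ a b : G, a * b ≠ b * a) :
    Nat.card (commutator G) = q ∨ Nat.card (commutator G) = q ^ 2 := by
  have := Fact.mk hq
  have := Fact.mk hp
  have : Finite G :=
    Nat.finite_of_card_ne_zero (hcard ▸ mul_ne_zero hp.ne_zero (pow_ne_zero 2 hq.ne_zero))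
  obtain ⟨Q, hQ⟩ := Sylow.exists_subgroup_card_pow_prime q (n := 2)
    (hcard ▸ dvd_mul_left (q ^ 2) p)
  have hidx : Q.index = p := by
    have := Q.card_mul_index
    rw [hQ, hcard, mul_comm] at this
    exact Nat.eq_of_mul_eq_mul_right (pow_pos hq.pos 2) this
  have hmin : (Nat.card G).minFac = p := by
    have hle : (Nat.card G).minFac ≤ p :=
      Nat.minFac_le_of_dvd hp.two_le (hcard ▸ dvd_mul_right p _)
    have hne : Nat.card G ≠ 1 := fun h1 =>
      hp.ne_one (Nat.dvd_one.1 (h1 ▸ hcard ▸ dvd_mul_right p (q ^ 2)))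
    have hprime := Nat.minFac_prime hne
    have hdvd : (Nat.card G).minFac ∣ p * q ^ 2 := hcard ▸ Nat.minFac_dvd _
    rcases hprime.dvd_mul.1 hdvd with h | h
    · exact (Nat.prime_dvd_prime_iff_eq hprime hp).1 h
    · have := (Nat.prime_dvd_prime_iff_eq hprime hq).1 (hprime.dvd_of_dvd_pow h)
      omega
  have hQn : Q.Normal := Subgroup.normal_of_index_eq_minFac_card (by rw [hidx, hmin])
  have hle : commutator G ≤ Q := by
    have : IsCyclic (G ⧸ Q) := isCyclic_of_prime_card (p := p) hidx
    let _ : CommGroup (G ⧸ Q) := IsCyclic.commGroup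
    have := Abelianization.commutator_subset_ker (QuotientGroup.mk' Q)
    rwa [QuotientGroup.ker_mk'] at this
  obtain ⟨k, hk, hx⟩ := (Nat.dvd_prime_pow hq).1 (hQ ▸ Subgroup.card_dvd_of_le hle)
  have hk0 : k ≠ 0 := by
    rintro rfl
    obtain ⟨a, b, hab⟩ := hnonab
    rw [pow_zero, Subgroup.card_eq_one] at hx
    refine hab (commutatorElement_eq_one_iff_mul_comm.1 ?_)
    rw [← Subgroup.mem_bot, ← hx]
    exact commutatorElement_mem a b
  interval_cases k
  · exact absurd rfl hk0
  · exact Or.inl (by rw [hx, pow_one])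
  · exact Or.inr hx

end classification

/-! ### The order of Ω and the extraspecial complement -/

namespace IsMetabelianGenerator

variable {G : Type u} [Group G] {n : ℕ} {π : G →* Multiplicative (ZMod n)} {s : G}

theorem derivedSquare_eq_bot_of_isCyclic (h : IsMetabelianGenerator π s)
    (hc : IsCyclic (commutator G)) : derivedSquare G = ⊥ := by
  obtain ⟨⟨e, he⟩, hgen⟩ := hc.exists_generator
  -- For cyclic G' the second generator may be taken trivial.
  have := h.derivedSquare_le_zpowers (e₁ := e) (e₂ := 1) ?_
  · rwa [tmul_one, Subgroup.zpowers_one_eq_bot, le_bot_iff] at this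
  · refine le_antisymm (fun v hv => ?_) ((Subgroup.closure_le _).2 ?_)
    · obtain ⟨k, hk⟩ := hgen ⟨v, hv⟩
      have hk' : e ^ k = v := congrArg Subtype.val hk
      exact hk' ▸ zpow_mem (Subgroup.subset_closure (Set.mem_insert _ _)) k
    · rintro _ (rfl | rfl)
      exacts [he, one_mem _]

variable {q : ℕ}

theorem card_derivedSquare_dvd [NeZero q] (h : IsMetabelianGenerator π s)
    (e : commutator G ≃* Multiplicative (ZMod q × ZMod q)) : Nat.card (derivedSquare G) ∣ q := by
  let e₁ := e.symm (Multiplicative.ofAdd (1, 0))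
  let e₂ := e.symm (Multiplicative.ofAdd (0, 1))
  have hgen : commutator G = Subgroup.closure {(e₁ : G), (e₂ : G)} := by
    refine le_antisymm (fun v hv => ?_) ((Subgroup.closure_le _).2 ?_)
    · obtain ⟨⟨a, b⟩, hx⟩ := Multiplicative.ofAdd.surjective (e ⟨v, hv⟩)
      have hv' : (⟨v, hv⟩ : commutator G) = e₁ ^ a.val * e₂ ^ b.val := by
        rw [← e.symm_apply_eq.2 hx, ← map_pow e.symm, ← map_pow e.symm, ← map_mul e.symm,
          ← ofAdd_nsmul, ← ofAdd_nsmul, ← ofAdd_add]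
        simp
      have hv'' : v = (e₁ : G) ^ a.val * (e₂ : G) ^ b.val := congrArg Subtype.val hv'
      rw [hv'']
      exact mul_mem (pow_mem (Subgroup.subset_closure (Set.mem_insert _ _)) _)
        (pow_mem (Subgroup.subset_closure (Set.mem_insert_of_mem _ (Set.mem_singleton _))) _)
    · rintro _ (rfl | rfl)
      exacts [e₁.2, e₂.2]
  have hq : ((e₁ : G) ⊗ₙ (e₂ : G)) ^ q = 1 := by
    have hp : (e₁ : G) ^ q = 1 := congrArg Subtype.val (pow_eq_one_of_mulEquiv e e₁)
    rw [← h.pow_tmul_derived e₁.2 e₂.2, hp, one_tmul]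
  refine (Subgroup.card_dvd_of_le (h.derivedSquare_le_zpowers hgen)).trans ?_
  rw [Nat.card_zpowers]
  exact orderOf_dvd_of_pow_eq_one hq

theorem schurMultiplier_cases [Finite G] (hq : q.Prime) (h : IsMetabelianGenerator π s)
    (e : commutator G ≃* Multiplicative (ZMod q × ZMod q)) :
    Subsingleton (SchurMultiplier G) ∨ Nonempty (SchurMultiplier G ≃+ ZMod q) := by
  have := Fact.mk hq
  rcases (Nat.dvd_prime hq).1 (h.card_schurMultiplier_dvd.trans (h.card_derivedSquare_dvd e))
    with h₁ | h₁
  · exact Or.inl (Nat.card_eq_one_iff_unique.1 h₁).1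
  · exact Or.inr ⟨addEquivOfPrimeCardEq (p := q) h₁ (Nat.card_zmod q)⟩

/-- Each symbol is killed by 2 and by the odd prime q. -/
theorem derivedSquare_eq_bot_of_subsingleton [Finite G] (hq : q.Prime) (hq2 : q ≠ 2)
    (h : IsMetabelianGenerator π s) (e : commutator G ≃* Multiplicative (ZMod q × ZMod q))
    [Subsingleton (SchurMultiplier G)] : derivedSquare G = ⊥ := by
  have := Fact.mk hq
  refine Subgroup.closure_eq_bot_iff.2 ?_
  rintro _ ⟨v, hv, w, hw, rfl⟩
  have h₁ := h.tmul_sq_eq_one_of_subsingleton hv hw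
  have h₂ : (v ⊗ₙ w) ^ q = 1 := by
    obtain ⟨m, hm⟩ := h.card_derivedSquare_dvd e
    have h₃ : (v ⊗ₙ w) ^ Nat.card (derivedSquare G) = 1 := congrArg Subtype.val
      (pow_card_eq_one' (x := (⟨v ⊗ₙ w, tmul_mem_derivedSquare hv hw⟩ : derivedSquare G)))
    rw [hm, pow_mul, h₃, one_pow]
  have h₄ := pow_gcd_eq_one.2 ⟨h₁, h₂⟩
  rwa [(Nat.coprime_primes Nat.prime_two hq).2 hq2.symm, pow_one] at h₄

theorem card_derivedSquare_eq [Finite G] (hq : q.Prime) (h : IsMetabelianGenerator π s)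
    (e : commutator G ≃* Multiplicative (ZMod q × ZMod q))
    (m : SchurMultiplier G ≃+ ZMod q) : Nat.card (derivedSquare G) = q := by
  have := Fact.mk hq
  have h₁ := h.card_schurMultiplier_dvd
  rw [Nat.card_congr m.toEquiv, Nat.card_zmod] at h₁
  exact Nat.dvd_antisymm (h.card_derivedSquare_dvd e) h₁

theorem card_ker_kerToCommutator [Finite G] (h : IsMetabelianGenerator π s) :
    Nat.card (kerToCommutator π).ker = Nat.card (derivedSquare G) :=
  Nat.card_congr
    { toFun := fun τ => ⟨τ, (h.mem_ker_kerToCommutator _).1 τ.2⟩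
      invFun := fun ω => ⟨⟨ω, h.derivedSquare_le_ker_pairing ω.2⟩,
        (h.mem_ker_kerToCommutator _).2 ω.2⟩
      left_inv := fun _ => rfl
      right_inv := fun _ => rfl }

theorem ker_kerToCommutator_le_center [Finite G] (h : IsMetabelianGenerator π s) :
    (kerToCommutator π).ker ≤ Subgroup.center (pairing π).ker := fun τ hτ =>
  Subgroup.mem_center_iff.2 fun σ => Subtype.ext <|
    Subgroup.mem_center_iff.1 (ker_toCommutator_le_center
      (h.derivedSquare_le_ker ((h.mem_ker_kerToCommutator τ).1 hτ))) (σ : TensorSquare G)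

/-- By `commutatorElement_eq`, v ⊗ w is the commutator of lifts of v and w to the kernel of the
pairing. -/
theorem derivedSquare_eq_bot_of_comm (h : IsMetabelianGenerator π s)
    (hc : ∀ x y : (pairing π).ker, x * y = y * x) : derivedSquare G = ⊥ := by
  refine Subgroup.closure_eq_bot_iff.2 ?_
  rintro _ ⟨v, hv, w, hw, rfl⟩
  obtain ⟨x, hx⟩ := h.kerToCommutator_surjective ⟨v, hv⟩
  obtain ⟨y, hy⟩ := h.kerToCommutator_surjective ⟨w, hw⟩
  have hx' : toCommutator (x : TensorSquare G) = v := congrArg Subtype.val hx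
  have hy' : toCommutator (y : TensorSquare G) = w := congrArg Subtype.val hy
  rw [Set.mem_singleton_iff, ← hx', ← hy', ← commutatorElement_eq,
    commutatorElement_eq_one_iff_mul_comm]
  exact congrArg Subtype.val (hc x y)

theorem card_ker_pairing [Finite G] (h : IsMetabelianGenerator π s) :
    Nat.card (pairing π).ker = Nat.card (derivedSquare G) * Nat.card (commutator G) := by
  rw [← (kerToCommutator π).ker.card_mul_index, h.card_ker_kerToCommutator, Subgroup.index_ker,
    MonoidHom.range_eq_top.2 h.kerToCommutator_surjective, Subgroup.card_top]

theorem isExtraspecial_ker_pairing [Finite G] (hq : q.Prime) (h : IsMetabelianGenerator π s)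
    (e : commutator G ≃* Multiplicative (ZMod q × ZMod q))
    (hΩ : Nat.card (derivedSquare G) = q) :
    IsExtraspecial q (pairing π).ker ∧ Nat.card (pairing π).ker = q ^ 3 := by
  have := Fact.mk hq
  have hD : Nat.card (commutator G) = q ^ 2 := by
    rw [Nat.card_congr e.toEquiv, Nat.card_congr Multiplicative.toAdd, Nat.card_prod,
      Nat.card_zmod, sq]
  have hcard : Nat.card (pairing π).ker = q ^ 3 := by
    rw [h.card_ker_pairing, hΩ, hD]; ring
  have : Finite (pairing π).ker := Nat.finite_of_card_ne_zero (hcard ▸ pow_ne_zero 3 hq.ne_zero)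
  have hnc : ¬ ∀ x y : (pairing π).ker, x * y = y * x := fun hc => by
    rw [h.derivedSquare_eq_bot_of_comm hc, Subgroup.card_bot] at hΩ
    exact hq.ne_one hΩ.symm
  set Z := Subgroup.center (pairing π).ker with hZ
  have hle := h.ker_kerToCommutator_le_center
  have hkcard : Nat.card (kerToCommutator π).ker = q := h.card_ker_kerToCommutator.trans hΩ
  have hZcard : Nat.card Z = q := by
    obtain ⟨k, hk, hx⟩ := (Nat.dvd_prime_pow hq).1 (hcard ▸ Z.card_subgroup_dvd_card)
    have hk1 : 1 ≤ k := by
      have := Subgroup.card_le_of_le hle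
      rw [hkcard, hx] at this
      by_contra! hk0
      rw [Nat.lt_one_iff.1 hk0, pow_zero] at this
      exact absurd this (not_le.2 hq.one_lt)
    have hidx : q ^ k * Z.index = q ^ 3 := by rw [← hx, Z.card_mul_index, hcard]
    have hcyc (hi : IsCyclic ((pairing π).ker ⧸ Z)) : False :=
      hnc (isMulCommutative_of_isCyclic_quotient_center_self (pairing π).ker).is_comm.comm
    -- A centre of order q² or q³ would have cyclic quotient, making the group abelian.
    interval_cases k
    · rw [hx, pow_one]
    · refine (hcyc (isCyclic_of_prime_card (p := q) ?_)).elim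
      refine Nat.eq_of_mul_eq_mul_left (pow_pos hq.pos 2) (hidx.trans ?_)
      ring
    · refine (hcyc ?_).elim
      have : Nat.card ((pairing π).ker ⧸ Z) = 1 :=
        Nat.eq_of_mul_eq_mul_left (pow_pos hq.pos 3) (hidx.trans (mul_one _).symm)
      have := (Nat.card_eq_one_iff_unique.1 this).1
      infer_instance
  -- The quotient by the centre thus embeds in G', which is elementary abelian.
  have hZker : (kerToCommutator π).ker = Z :=
    Subgroup.eq_of_le_of_card_ge hle (by rw [hkcard, hZcard])
  refine ⟨⟨IsPGroup.of_card hcard, hZcard, ?_, ?_, ?_⟩, hcard⟩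
  · rw [← not_subsingleton_iff_nontrivial]
    intro hs
    rw [QuotientGroup.subsingleton_iff, Subgroup.center_eq_top_iff] at hs
    exact hnc hs.is_comm.comm
  · intro a b
    induction a using QuotientGroup.induction_on with | H a => ?_
    induction b using QuotientGroup.induction_on with | H b => ?_
    rw [← QuotientGroup.mk_mul, ← QuotientGroup.mk_mul, QuotientGroup.eq, ← hZ, ← hZker,
      MonoidHom.mem_ker, map_mul, map_inv, inv_mul_eq_one]
    exact Subtype.ext (by simpa using h.comm _ (kerToCommutator π a).2 _ (kerToCommutator π b).2)
  · intro a
    induction a using QuotientGroup.induction_on with | H a => ?_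
    rw [← QuotientGroup.mk_pow, QuotientGroup.eq_one_iff, ← hZ, ← hZker, MonoidHom.mem_ker,
      map_pow]
    exact pow_eq_one_of_mulEquiv e _

end IsMetabelianGenerator

/-! ### The three cases -/

theorem theoremC {G : Type u} [Group G] (p q : ℕ) (hp : p.Prime) (hq : q.Prime) (hpq : p < q)
    (hcard : Nat.card G = p * q ^ 2) (hnonab : ∃ a b : G, a * b ≠ b * a) :
    -- one of the three cases occurs
    (Nonempty (commutator G ≃* Multiplicative (ZMod (q ^ 2))) ∨
      (Nonempty (commutator G ≃* Multiplicative (ZMod q × ZMod q)) ∧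
          Subsingleton (SchurMultiplier G) ∨
        Nonempty (commutator G ≃* Multiplicative (ZMod q))) ∨
      (Nonempty (commutator G ≃* Multiplicative (ZMod q × ZMod q)) ∧
        Nonempty (SchurMultiplier G ≃+ ZMod q))) ∧
    -- (i)
    (Nonempty (commutator G ≃* Multiplicative (ZMod (q ^ 2))) →
      Nonempty (TensorSquare G ≃* Multiplicative (ZMod (p * q ^ 2)))) ∧
    -- (ii)
    (Nonempty (commutator G ≃* Multiplicative (ZMod q × ZMod q)) ∧
          Subsingleton (SchurMultiplier G) ∨
        Nonempty (commutator G ≃* Multiplicative (ZMod q)) →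
      Nonempty (TensorSquare G ≃* Multiplicative (ZMod p × ZMod q × ZMod q))) ∧
    -- (iii)
    (Nonempty (commutator G ≃* Multiplicative (ZMod q × ZMod q)) ∧
        Nonempty (SchurMultiplier G ≃+ ZMod q) →
      ∃ (H : Type u) (_ : Group H), IsExtraspecial q H ∧ Nat.card H = q ^ 3 ∧
        Nonempty (TensorSquare G ≃* Multiplicative (ZMod p) × H)) := by
  have := Fact.mk hq
  have := Fact.mk hp
  have : Finite G :=
    Nat.finite_of_card_ne_zero (hcard ▸ mul_ne_zero hp.ne_zero (pow_ne_zero 2 hq.ne_zero))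
  have hcop : p.Coprime q := (Nat.coprime_primes hp hq).2 hpq.ne
  have hq2 : q ≠ 2 := (hp.two_le.trans_lt hpq).ne'
  have hprod : Nat.card (commutator G) * Nat.card (Abelianization G) = p * q ^ 2 :=
    hcard ▸ (commutator G).card_mul_index
  have hsqcard : Nat.card (Multiplicative (ZMod q × ZMod q)) = q ^ 2 := by
    rw [Nat.card_congr Multiplicative.toAdd, Nat.card_prod, Nat.card_zmod, sq]
  have hsq (hc : Nat.card (commutator G) = q ^ 2)
      (hcomm : ∀ v ∈ commutator G, ∀ w ∈ commutator G, v * w = w * v) :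
      ∃ (π : G →* Multiplicative (ZMod p)) (s : G), IsMetabelianGenerator π s := by
    have hA : Nat.card (Abelianization G) = p := by
      rw [hc, mul_comm] at hprod
      exact Nat.eq_of_mul_eq_mul_right (pow_pos hq.pos 2) hprod
    exact exists_isMetabelianGenerator hcomm (isCyclic_of_prime_card hA) hA
  have hsq' (e : commutator G ≃* Multiplicative (ZMod q × ZMod q)) :=
    hsq ((Nat.card_congr e.toEquiv).trans hsqcard) (mul_comm_of_mulEquiv e)
  refine ⟨?_, ?_, ?_, ?_⟩
  · rcases card_commutator_of_card_eq hp hq hpq hcard hnonab with hc | hc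
    · exact Or.inr (Or.inl (Or.inr
        (nonempty_mulEquiv_zmod_of_card (isCyclic_of_prime_card hc) hc)))
    · rcases nonempty_mulEquiv_of_card_eq_sq hq hc with he | ⟨⟨e⟩⟩
      · exact Or.inl he
      · obtain ⟨π, s, h⟩ := hsq' e
        rcases h.schurMultiplier_cases hq e with hM | hM
        · exact Or.inr (Or.inl (Or.inl ⟨⟨e⟩, hM⟩))
        · exact Or.inr (Or.inr ⟨⟨e⟩, hM⟩)
  · rintro ⟨e⟩
    obtain ⟨π, s, h⟩ := hsq ((Nat.card_congr e.toEquiv).trans (Nat.card_zmod _))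
      (mul_comm_of_mulEquiv e)
    obtain ⟨f⟩ := h.nonempty_mulEquiv_of_derivedSquare_eq_bot
      (h.derivedSquare_eq_bot_of_isCyclic (isCyclic_of_surjective e.symm e.symm.surjective))
    exact ⟨f.trans <| (MulEquiv.prodCongr (MulEquiv.refl _) e).trans <|
      (MulEquiv.prodMultiplicative _ _).symm.trans <| AddEquiv.toMultiplicative
        (ZMod.chineseRemainder (hcop.pow_right 2)).toAddEquiv.symm⟩
  · rintro (⟨⟨e⟩, hM⟩ | ⟨⟨e⟩⟩)
    · obtain ⟨π, s, h⟩ := hsq' e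
      obtain ⟨f⟩ := h.nonempty_mulEquiv_of_derivedSquare_eq_bot
        (h.derivedSquare_eq_bot_of_subsingleton hq hq2 e)
      exact ⟨f.trans <| (MulEquiv.prodCongr (MulEquiv.refl _) e).trans
        (MulEquiv.prodMultiplicative _ _).symm⟩
    -- Here n = pq: the abelianization supplies ℤ/p and one factor ℤ/q, and G' the other.
    · have hA : Nat.card (Abelianization G) = p * q := by
        rw [Nat.card_congr e.toEquiv, Nat.card_congr Multiplicative.toAdd, Nat.card_zmod] at hprod
        refine Nat.eq_of_mul_eq_mul_left hq.pos (hprod.trans ?_)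
        ring
      obtain ⟨π, s, h⟩ := exists_isMetabelianGenerator (mul_comm_of_mulEquiv e)
        (isCyclic_of_card_eq_mul hp hq hpq.ne hA) hA
      obtain ⟨f⟩ := h.nonempty_mulEquiv_of_derivedSquare_eq_bot
        (h.derivedSquare_eq_bot_of_isCyclic (isCyclic_of_surjective e.symm e.symm.surjective))
      exact ⟨f.trans <| (MulEquiv.prodCongr (AddEquiv.toMultiplicative
        (ZMod.chineseRemainder hcop).toAddEquiv) e).trans <|
          (MulEquiv.prodMultiplicative _ _).symm.trans <| AddEquiv.toMultiplicative
            AddEquiv.prodAssoc⟩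
  · rintro ⟨⟨e⟩, ⟨m⟩⟩
    obtain ⟨π, s, h⟩ := hsq' e
    obtain ⟨h₁, h₂⟩ := h.isExtraspecial_ker_pairing hq e (h.card_derivedSquare_eq hq e m)
    exact ⟨(pairing π).ker, inferInstance, h₁, h₂, h.nonempty_mulEquiv_prod_ker⟩
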